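/- Let $k\ge 1$ be an integer and $t\in(0,1]$. Let $\mathcal A$ be a unital $C^*$-algebra with a faithful tracial state $\phi$ (for instance a $\mathrm{II}_1$ factor with its trace). Suppose that $\mathbb R^k$, with coordinatewise operations, is embedded as a unital real algebra of self-adjoint elements of $\mathcal A$ in such a way that $\phi(x)=(x_1+\cdots+x_k)/k$ for $x\in\mathbb R^k$, and let $p_t\in\mathcal A$ be a self-adjoint projection with $\phi(p_t)=t$ that is free from the image of $\mathbb R^k$. The $(t)$-norm of $x\in\mathbb R^k$ is the operator norm $$\|x\|_{(t)}=\|p_t\,x\,p_t\|.$$ Put $1^k=(1,\dots,1)$, $\mu_x=\frac1k\sum_{i=1}^k\delta_{x_i}$, and let $\mu_x^{\boxplus 1/t}$ be the free additive convolution power, that is, the compactly supported probability measure on $\mathbb R$ whose free cumulants are $1/t$ times those of $\mu_x$. Let $\Delta_k^\downarrow=\{y\in\mathbb R^k: y_1\ge\cdots\ge y_k\ge 0,\ \sum_i y_i=1\}$. Then $\|\cdot\|_{(t)}$ does not depend on the choice of $\mathcal A$, $\phi$, the embedding and $p_t$; it is a norm on $\mathbb R^k$, and it has the following properties. 1. For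 every permutation $\sigma$ of $\{1,\dots,k\}$ and every $x\in\mathbb R^k$, $\|(x_{\sigma(1)},\dots,x_{\sigma(k)})\|_{(t)}=\|x\|_{(t)}$. 2. If $\|x\|_{(t)}$ is achieved at the upper bound of the support of $\mu_x^{\boxplus 1/t}$, i.e. $\|x\|_{(t)}=t\,\max\operatorname{supp}\mu_x^{\boxplus 1/t}$, then $\|x+s1^k\|_{(t)}=\|x\|_{(t)}+s$ for all $s\ge 0$. If it is achieved at the lower bound, i.e. $\|x\|_{(t)}=-t\,\min\operatorname{supp}\mu_x^{\boxplus 1/t}$, then $\|x+s1^k\|_{(t)}=\|x\|_{(t)}-s$ for all $s\le 0$. 3. The $(t)$-norm is determined by its restriction to $\Delta_k^\downarrow$: if $t'\in(0,1]$ and $\|y\|_{(t')}=\|y\|_{(t)}$ for all $y\in\Delta_k^\downarrow$, then $\|x\|_{(t')}=\|x\|_{(t)}$ for all $x\in\mathbb R^k$. Explicitly, for $v\in\mathbb R^k$ with $v_i>0$ for all $i$ let $|v|=\sum_i v_i$ and let $\hat v\in\Delta_k^\downarrow$ be the decreasing rearrangement of $v/|v|$; then for all $x\in\mathbb R^k$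 and all real $s>\|x\|_\infty$, $$\|x\|_{(t)}=\max\bigl\{\,|v|\,\|\hat v\|_{(t)}-s,\ |w|\,\|\hat w\|_{(t)}-s\,\bigr\},\qquad v=s1^k+x,\quad w=s1^k-x.$$ 4. If $t>1-\frac1k$, then $\|x\|_{(t)}=\|x\|_\infty=\max_i|x_i|$ for all $x\in\mathbb R^k$. -/

import Mathlib

open scoped ComplexOrder

/-- A faithful tracial state on a unital C*-algebra. The trace of a `II₁` factor is one. -/
structure IsFaithfulTracialState {A : Type*} [CStarAlgebra A] (φ : A →ₗ[ℂ] ℂ) : Prop where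
  map_one : φ 1 = 1
  nonneg : ∀ a : A, 0 ≤ φ (star a * a)
  tracial : ∀ a b : A, φ (a * b) = φ (b * a)
  faithful : ∀ a : A, φ (star a * a) = 0 → a = 0

/-- Freeness of a family of unital subalgebras: a nonempty alternating product of centered
elements is centered. -/
def AreFreeSubalgebras {A : Type*} [CStarAlgebra A] (φ : A →ₗ[ℂ] ℂ) {I : Type*}
    (B : I → Subalgebra ℂ A) : Prop :=
  ∀ (n : ℕ) (j : Fin (n + 1) → I) (a : Fin (n + 1) → A),
    (∀ i, a i ∈ B (j i)) → (∀ i, φ (a i) = 0) →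
    (∀ i : Fin n, j i.castSucc ≠ j i.succ) →
    φ (List.ofFn a).prod = 0

/-- Freeness of a family of sets of random variables: the unital subalgebras that they generate
are free. -/
def AreFree {A : Type*} [CStarAlgebra A] (φ : A →ₗ[ℂ] ℂ) {I : Type*} (S : I → Set A) : Prop :=
  AreFreeSubalgebras φ (fun i => Algebra.adjoin ℂ (S i))

/-- The data from which the `(t)`-norm on `ℝ^k` is built: a faithful tracial state `φ`, an
embedding of the real algebra `ℝ^k` by self-adjoint elements, on which `φ` is the average of the
coordinates, and a projection of trace `t` that is free from the image of `ℝ^k`. -/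
structure TNormModel {A : Type*} [CStarAlgebra A] (φ : A →ₗ[ℂ] ℂ) (k : ℕ) (t : ℝ) where
  isState : IsFaithfulTracialState φ
  /-- the embedding; the involution of `ℝ^k` is trivial, so its values are self-adjoint -/
  embed : (Fin k → ℝ) →⋆ₐ[ℝ] A
  embed_injective : Function.Injective embed
  trace_embed : ∀ x, φ (embed x) = (((∑ i, x i) / k : ℝ) : ℂ)
  /-- the projection `p_t` -/
  proj : A
  isStarProjection_proj : IsStarProjection proj
  trace_proj : φ proj = (t : ℂ)
  free : AreFree φ ![Set.range embed, {proj}]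

/-- The `(t)`-norm of `x`, the operator norm of `p_t x p_t`. -/
noncomputable def TNormModel.tNorm {A : Type*} [CStarAlgebra A] {φ : A →ₗ[ℂ] ℂ} {k : ℕ} {t : ℝ}
    (M : TNormModel φ k t) (x : Fin k → ℝ) : ℝ :=
  ‖M.proj * M.embed x * M.proj‖

/-- `f` is a norm on the real vector space `ℝ^k`. -/
structure IsNormOn {k : ℕ} (f : (Fin k → ℝ) → ℝ) : Prop where
  nonneg : ∀ x, 0 ≤ f x
  eq_zero_iff : ∀ x, f x = 0 ↔ x = 0
  smul : ∀ (c : ℝ) (x), f (c • x) = |c| * f x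
  add_le : ∀ x y, f (x + y) ≤ f x + f y

/-- The probability measure `μ_x = k⁻¹ ∑ δ_{x_i}`. -/
noncomputable def empiricalMeasure {k : ℕ} (x : Fin k → ℝ) : MeasureTheory.Measure ℝ :=
  (k : ENNReal)⁻¹ • ∑ i, MeasureTheory.Measure.dirac (x i)

/-- The free cumulants `κ_n` of a moment sequence `m` (with `m 0 = 1`), by the moment-cumulant
relation `m_n = ∑_{r=1}^n κ_r ∑_{i_1 + ⋯ + i_r = n - r} m_{i_1} ⋯ m_{i_r}`. The inner sum is the
coefficient of `z^(n-r)` in `(∑ m_i z^i)^r`; for `r = 0 < n` that coefficient vanishes. -/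
noncomputable def freeCumulant (m : ℕ → ℝ) (n : ℕ) : ℝ :=
  m n - ∑ r : Fin n, freeCumulant m r * PowerSeries.coeff (n - r) (PowerSeries.mk m ^ (r : ℕ))
termination_by n
decreasing_by exact r.2

/-- The moment sequence of a measure on the line. -/
noncomputable def momentSeq (μ : MeasureTheory.Measure ℝ) (n : ℕ) : ℝ := ∫ u, u ^ n ∂μ

/-- `ν` is a free additive convolution power `μ^{⊞ s}` of the compactly supported probability
measure `μ`: a compactly supported probability measure whose free cumulants are `s` times those
of `μ`. -/
structure IsFreeConvPower (s : ℝ) (μ ν : MeasureTheory.Measure ℝ) : Prop where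
  isProbabilityMeasure : MeasureTheory.IsProbabilityMeasure ν
  isCompact_support : IsCompact ν.support
  freeCumulant_eq : ∀ n, 1 ≤ n →
    freeCumulant (momentSeq ν) n = s * freeCumulant (momentSeq μ) n

open Classical in
/-- The free additive convolution power `μ^{⊞ s}`. For `s ≥ 1` and `μ` a compactly supported
probability measure it exists and is unique. -/
noncomputable def freeConvPower (s : ℝ) (μ : MeasureTheory.Measure ℝ) : MeasureTheory.Measure ℝ :=
  if h : ∃ ν, IsFreeConvPower s μ ν then h.choose else 0

/-- The ordered probability simplex `Δ_k^↓`. -/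
def orderedSimplex (k : ℕ) : Set (Fin k → ℝ) :=
  {y | (∀ i, 0 ≤ y i) ∧ Antitone y ∧ ∑ i, y i = 1}

/-- The coordinates of `v` in decreasing order, divided by their sum. -/
noncomputable def orderedNormalization {k : ℕ} (v : Fin k → ℝ) : Fin k → ℝ :=
  fun i => v (Tuple.sort (fun j => -v j) i) / ∑ j, v j

theorem orderedNormalization_mem {k : ℕ} {v : Fin k → ℝ} (hv : ∀ i, 0 ≤ v i)
    (hs : 0 < ∑ i, v i) : orderedNormalization v ∈ orderedSimplex k := by
  refine ⟨fun i => div_nonneg (hv _) hs.le, fun i j hij => ?_, ?_⟩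
  · have h := Tuple.monotone_sort (fun j => -v j) hij
    simp only [Function.comp_apply, neg_le_neg_iff] at h
    exact div_le_div_of_nonneg_right h hs.le
  · simp only [orderedNormalization]
    rw [← Finset.sum_div, Equiv.sum_comp (Tuple.sort (fun j => -v j)) v, div_self hs.ne']

/-! The law of `p x p / t` in the corner of `p`, with state `φ(p ·) / t`, is `μ_x^{⊞ 1/t}`, and most
of the theorem follows from this. Since `φ` is faithful and tracial, `‖p x p‖` is the growth rate of
the even moments of `p x p`; these are determined by free cumulants, hence by `t` and the power sums
of `x`. So the norm is independent of the model and permutation invariant. If `p x p = 0`, undoing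
the scaling of the cumulants shows that the second moment of `x` vanishes.

The cumulant formula is obtained with formal power series. Let `m` be the moment series of `x`, `u =
1 + (m - 1) / t` and `R = (1 - w x)⁻¹`. For `z = w m / u`, `resolvent_factorization` equates `R (1 -
z x p / t) ((1 - p) + u p)` with `m - (R - m)(p - t) / t`. The inverse of the latter has
coefficients spanned by alternating words in centered elements, on which freeness makes the relevant
traces vanish. Hence `φ((1 - z x p / t)⁻¹) = m` (`compression_functional`), and this subordination
says that cumulants are multiplied by `1 / t` (`freeCumulant_of_subst_eq`).

For property 2, `|t u + s| ≤ ‖p (x + s) p‖` at each support point `u`; the triangle inequality gives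
the other direction. For property 3, `‖a‖` or `-‖a‖` lies in the spectrum of `a = p x p`, so one of
`s p + a`, `s p - a` has norm `‖a‖ + s`; homogeneity and symmetry then reduce to the simplex.
Property 4 needs no freeness: a coordinate projection and `p` have traces of sum greater than one,
hence a common approximate range vector (`exists_approx_common`), which is an approximate
eigenvector of `p x p` for `x_i`. -/

/-! ### Moment series and free cumulant series. -/

section FormalSeries

open PowerSeries

theorem coeff_subst_X_mul_of_lt (f M : PowerSeries ℝ) {n N : ℕ} (hN : n < N) :
    coeff n (f.subst (X * M)) = ∑ r ∈ Finset.range N, coeff r f * coeff n ((X * M) ^ r) := by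
  rw [coeff_subst' (HasSubst.of_constantCoeff_zero' (by simp)),
    finsum_eq_sum_of_support_subset (s := Finset.range N)]
  · simp
  · intro r hr
    by_contra h
    simp only [Finset.coe_range, Set.mem_Iio, not_lt] at h
    apply hr
    simp only [mul_pow, coeff_X_pow_mul']
    rw [if_neg (by omega), smul_zero]

theorem coeff_subst_X_mul (f M : PowerSeries ℝ) (n : ℕ) :
    coeff n (f.subst (X * M)) = ∑ r ∈ Finset.range (n + 1), coeff r f * coeff (n - r) (M ^ r) := by
  rw [coeff_subst_X_mul_of_lt f M n.lt_succ_self]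
  refine Finset.sum_congr rfl fun r hr => ?_
  rw [mul_pow, coeff_X_pow_mul', if_pos (Nat.lt_succ_iff.1 (Finset.mem_range.1 hr))]

/-- The system is triangular: coefficient `n` of the composite is coefficient `n` of `f` plus a
combination of earlier ones. -/
theorem subst_X_mul_injective {M : PowerSeries ℝ} (hM : constantCoeff M = 1) :
    Function.Injective fun f : PowerSeries ℝ => f.subst (X * M) := by
  intro f g hfg
  ext n
  induction n using Nat.strong_induction_on with
  | _ n ih =>
    have h := congrArg (coeff n) hfg
    simp only [coeff_subst_X_mul, Finset.sum_range_succ] at h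
    rw [Finset.sum_congr rfl fun r hr => by rw [ih r (Finset.mem_range.1 hr)]] at h
    simpa [hM] using h

theorem freeCumulant_zero (m : ℕ → ℝ) : freeCumulant m 0 = m 0 := by
  rw [freeCumulant]
  simp

/-- The moment-cumulant relation `M(z) = C(z M(z))`. -/
theorem subst_mk_freeCumulant (m : ℕ → ℝ) (h : m 0 = 1) :
    (mk (freeCumulant m)).subst (X * mk m) = mk m := by
  ext n
  rw [coeff_subst_X_mul, Finset.sum_range_succ, coeff_mk, coeff_mk, freeCumulant,
    Finset.sum_range fun r => coeff r (mk (freeCumulant m)) * coeff (n - r) (mk m ^ r)]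
  simp [h]

theorem coeff_pow_congr {M N : PowerSeries ℝ} {j : ℕ} (h : ∀ i ≤ j, coeff i M = coeff i N)
    (r : ℕ) : ∀ i ≤ j, coeff i (M ^ r) = coeff i (N ^ r) := by
  induction r with
  | zero => simp
  | succ r ih =>
    intro i hi
    rw [pow_succ, pow_succ, coeff_mul, coeff_mul]
    refine Finset.sum_congr rfl fun ij hij => ?_
    have := Finset.HasAntidiagonal.mem_antidiagonal.1 hij
    rw [ih _ (by omega), h _ (by omega)]

/-- The free cumulants determine the moments. -/
theorem eq_of_freeCumulant_eq {m n : ℕ → ℝ} (h0 : m 0 = n 0)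
    (h : ∀ r, 1 ≤ r → freeCumulant m r = freeCumulant n r) : m = n := by
  have hall : ∀ r, freeCumulant m r = freeCumulant n r := by
    intro r
    rcases Nat.eq_zero_or_pos r with rfl | hr
    · rw [freeCumulant_zero, freeCumulant_zero, h0]
    · exact h r hr
  funext j
  induction j using Nat.strong_induction_on with
  | _ j ih =>
    have hj := hall j
    rw [freeCumulant, freeCumulant] at hj
    have : ∀ r : Fin j, freeCumulant m r * coeff (j - r) (mk m ^ (r : ℕ)) =
        freeCumulant n r * coeff (j - r) (mk n ^ (r : ℕ)) := by
      intro r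
      rw [hall]
      rcases Nat.eq_zero_or_pos (r : ℕ) with hr | hr
      · rw [hr, pow_zero, pow_zero]
      · rw [coeff_pow_congr (j := j - r) (fun i hi => ?_) r _ le_rfl]
        rw [coeff_mk, coeff_mk, ih i (by have := r.2; omega)]
    rw [Finset.sum_congr rfl fun r _ => this r] at hj
    linarith

/-- If the moment series `N` is subordinate to the moment series `M` as for a free compression of
trace `t`, then the free cumulants are multiplied by `1 / t`. -/
theorem freeCumulant_of_subst_eq {m n : ℕ → ℝ} (hm : m 0 = 1) (hn : n 0 = 1) {t : ℝ}
    {u : PowerSeries ℝ} (hu : u = 1 + C t⁻¹ * (mk m - 1))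
    (h : (mk n).subst (X * mk m * u⁻¹) = u) (r : ℕ) (hr : 1 ≤ r) :
    freeCumulant n r = 1 / t * freeCumulant m r := by
  have hM : constantCoeff (mk m) = 1 := by
    rw [← coeff_zero_eq_constantCoeff_apply, coeff_mk, hm]
  have hu0 : constantCoeff u ≠ 0 := by simp [hu, hM]
  have hz : HasSubst (X * mk m * u⁻¹) := HasSubst.of_constantCoeff_zero' (by simp)
  have hw : HasSubst (X * mk m) := HasSubst.of_constantCoeff_zero' (by simp)
  have hN : HasSubst (X * mk n) := HasSubst.of_constantCoeff_zero' (by simp)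
  -- At `y = X M u⁻¹` the hypothesis is `N(y) = u`, so `y N(y) = X M` and the relation `C_N(y N(y))
  -- = N(y)` becomes `C_N(X M) = u`.
  have h1 : (mk (freeCumulant n)).subst (X * mk m) = u := by
    conv_rhs => rw [← h, ← subst_mk_freeCumulant n hn]
    rw [subst_comp_subst_apply hN hz, subst_mul hz, subst_X hz, h, mul_assoc,
      PowerSeries.inv_mul_cancel _ hu0, mul_one]
  have h2 : (1 + C t⁻¹ * (mk (freeCumulant m) - 1)).subst (X * mk m) = u := by
    have hC : ∀ c : ℝ, (C c).subst (X * mk m) = C c := fun c => subst_C c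
    have h1' : (1 : PowerSeries ℝ).subst (X * mk m) = 1 := by simpa using hC 1
    rw [subst_add hw, subst_mul hw, subst_sub hw, hC, h1', subst_mk_freeCumulant m hm, hu]
  have h3 := congrArg (coeff r) (subst_X_mul_injective hM (h1.trans h2.symm))
  have hr' : r ≠ 0 := by omega
  simpa [coeff_one, hr'] using h3

end FormalSeries

/-! ### Power series over a noncommutative algebra. -/

section CoefficientwiseAlgebra

open PowerSeries

variable {A : Type*} [Ring A] [Algebra ℝ A]

/-- Formal power series over an algebra form an algebra over the scalar formal power series. -/
noncomputable instance powerSeriesAlgebra : Algebra (PowerSeries ℝ) (PowerSeries A) :=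
  RingHom.toAlgebra' (PowerSeries.map (algebraMap ℝ A)) fun s Y => by
    ext n
    rw [coeff_mul, coeff_mul, ← Finset.Nat.sum_antidiagonal_swap]
    exact Finset.sum_congr rfl fun ij _ => by simp [Algebra.commutes]

theorem coeff_series_smul (s : PowerSeries ℝ) (Y : PowerSeries A) (n : ℕ) :
    coeff n (s • Y) = ∑ ij ∈ Finset.HasAntidiagonal.antidiagonal n, coeff ij.1 s • coeff ij.2 Y := by
  rw [Algebra.smul_def, coeff_mul]
  exact Finset.sum_congr rfl fun ij _ => by
    rw [Algebra.smul_def]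
    congr 1

/-- The coefficientwise extension of a linear functional to formal power series. -/
noncomputable def seriesFunctional (τ : A →ₗ[ℝ] ℝ) : PowerSeries A →ₗ[PowerSeries ℝ]
    PowerSeries ℝ where
  toFun Y := mk fun n => τ (coeff n Y)
  map_add' Y Z := by ext; simp
  map_smul' s Y := by
    ext n
    simp [coeff_series_smul, coeff_mul]

theorem coeff_seriesFunctional (τ : A →ₗ[ℝ] ℝ) (Y : PowerSeries A) (n : ℕ) :
    coeff n (seriesFunctional τ Y) = τ (coeff n Y) := by
  simp [seriesFunctional]

/-- The geometric series `∑ (z(w) a)^n` with `z(w) = w G(w)`. -/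
noncomputable def geometricSeries (G : PowerSeries ℝ) (a : A) : PowerSeries A :=
  mk fun j => ∑ r ∈ Finset.range (j + 1), coeff j ((X * G) ^ r) • a ^ r

theorem coeff_geometricSeries (G : PowerSeries ℝ) (a : A) {j N : ℕ} (h : j < N) :
    coeff j (geometricSeries G a) = ∑ r ∈ Finset.range N, coeff j ((X * G) ^ r) • a ^ r := by
  rw [geometricSeries, coeff_mk]
  refine Finset.sum_subset (fun r hr => ?_) fun r _ hr => ?_
  · simp only [Finset.mem_range] at hr ⊢
    omega
  · simp only [Finset.mem_range, not_lt] at hr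
    rw [mul_pow, coeff_X_pow_mul', if_neg (by omega), zero_smul]

theorem geometricSeries_spec (G : PowerSeries ℝ) (a : A) :
    (1 - (X * G) • C a) * geometricSeries G a = 1 := by
  rw [sub_mul, one_mul, smul_mul_assoc, sub_eq_iff_eq_add]
  ext j
  rw [map_add, coeff_series_smul, coeff_geometricSeries G a (N := j + 2) (by omega),
    Finset.sum_range_succ']
  have h : ∀ ij ∈ Finset.HasAntidiagonal.antidiagonal j,
      coeff ij.1 (X * G) • coeff ij.2 (C a * geometricSeries G a) =
        ∑ r ∈ Finset.range (j + 1), (coeff ij.1 (X * G) * coeff ij.2 ((X * G) ^ r)) • a ^ (r + 1) := by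
    intro ij hij
    have := Finset.HasAntidiagonal.mem_antidiagonal.1 hij
    rw [coeff_C_mul, coeff_geometricSeries G a (N := j + 1) (by omega), Finset.mul_sum,
      Finset.smul_sum]
    refine Finset.sum_congr rfl fun r _ => ?_
    rw [mul_smul_comm, smul_smul, pow_succ']
  rw [Finset.sum_congr rfl h, Finset.sum_comm, add_comm]
  congr 1
  · rcases j with - | j <;> simp [coeff_one]
  · refine Finset.sum_congr rfl fun r _ => ?_
    rw [← Finset.sum_smul, pow_succ' (X * G), coeff_mul]

theorem seriesFunctional_mul_comm {τ : A →ₗ[ℝ] ℝ} (hτ : ∀ a b, τ (a * b) = τ (b * a))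
    (Y Z : PowerSeries A) : seriesFunctional τ (Y * Z) = seriesFunctional τ (Z * Y) := by
  ext n
  rw [coeff_seriesFunctional, coeff_seriesFunctional, coeff_mul, coeff_mul,
    ← Finset.Nat.sum_antidiagonal_swap, map_sum, map_sum]
  exact Finset.sum_congr rfl fun ij _ => hτ _ _

/-- Reduces vanishing of the trace of a product of series to a check on `V`, later the span of
alternating words. -/
theorem seriesFunctional_mul_eq_zero {τ : A →ₗ[ℝ] ℝ} {V : Submodule ℝ A} {Y W : PowerSeries A}
    (hW : ∀ n, coeff n W ∈ V) (hY : ∀ n, ∀ v ∈ V, τ (coeff n Y * v) = 0) :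
    seriesFunctional τ (Y * W) = 0 := by
  ext n
  rw [coeff_seriesFunctional, coeff_mul, map_sum, map_zero]
  exact Finset.sum_eq_zero fun ij _ => hY _ _ (hW _)

/-- A submodule that contains `1` and is stable under the coefficients of a series `Y` without
constant term contains the coefficients of `(m - Y)⁻¹`. -/
theorem coeff_mem_of_mul_eq_one {V : Submodule ℝ A} (h1 : (1 : A) ∈ V) {Y W : PowerSeries A}
    {m : PowerSeries ℝ} (hm : constantCoeff m = 1) (hY0 : coeff 0 Y = 0)
    (hY : ∀ n, ∀ v ∈ V, coeff n Y * v ∈ V) (hW : (m • (1 : PowerSeries A) - Y) * W = 1) (n : ℕ) :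
    coeff n W ∈ V := by
  induction n using Nat.strong_induction_on with
  | _ n ih =>
    -- Coefficient `n` of `m W = 1 + Y W`, solved for that of `W`: as `m` starts with `1` and `Y`
    -- has no constant term, only earlier coefficients of `W` remain.
    have h := congrArg (coeff n) hW
    rw [sub_mul, smul_mul_assoc, one_mul, map_sub, sub_eq_iff_eq_add, coeff_series_smul, coeff_mul,
      Finset.Nat.sum_antidiagonal_eq_sum_range_succ_mk,
      Finset.Nat.sum_antidiagonal_eq_sum_range_succ_mk, Finset.sum_range_succ',
      Finset.sum_range_succ', hY0, zero_mul, add_zero, coeff_zero_eq_constantCoeff_apply, hm,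
      one_smul, Nat.sub_zero, ← eq_sub_iff_add_eq'] at h
    rw [h]
    refine V.sub_mem (V.add_mem ?_ (V.sum_mem fun i hi => hY _ _ (ih _ ?_)))
      (V.sum_mem fun i hi => V.smul_mem _ (ih _ ?_))
    · rw [coeff_one]
      split_ifs
      exacts [h1, V.zero_mem]
    all_goals
      have := Finset.mem_range.1 hi
      omega

theorem seriesFunctional_geometricSeries (τ : A →ₗ[ℝ] ℝ) (G : PowerSeries ℝ) (a : A) :
    seriesFunctional τ (geometricSeries G a) = (mk fun n => τ (a ^ n)).subst (X * G) := by
  ext j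
  rw [coeff_seriesFunctional, coeff_geometricSeries G a j.lt_succ_self,
    coeff_subst_X_mul_of_lt _ _ j.lt_succ_self, map_sum]
  exact Finset.sum_congr rfl fun r _ => by simp [mul_comm]

end CoefficientwiseAlgebra

/-! ### The algebraic identity behind free compression. -/

section Compression

/-- The point is that `R - m` and `p - d` are centered when `m` and `d` are the traces of `R` and
`p`, so the right side is a scalar minus a product of centered factors. -/
theorem resolvent_factorization {S B : Type*} [CommRing S] [Ring B] [Algebra S B] {R x p : B}
    {w m u z c d : S} (hp : p * p = p) (hR : w • (R * x) = R - 1) (hz : z * u = w * m)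
    (hu : u = 1 + c * (m - 1)) (hcd : c * d = 1) :
    R * (1 - (z * c) • (x * p)) * ((1 - p) + u • p) =
      m • (1 : B) - c • ((R - m • (1 : B)) * (p - d • (1 : B))) := by
  have h1 : R * (1 - (z * c) • (x * p)) * ((1 - p) + u • p) =
      R - R * p + u • (R * p) - (c * (z * u)) • (R * x * p) := by
    have e1 : x * p * (1 - p) = 0 := by rw [mul_assoc, mul_sub, hp, mul_one, sub_self, mul_zero]
    have e2 : x * p * p = x * p := by rw [mul_assoc, hp]
    rw [mul_assoc, sub_mul, one_mul, smul_mul_assoc, mul_add, e1, mul_smul_comm, e2, zero_add,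
      mul_sub, mul_smul_comm, mul_smul_comm, mul_add, mul_sub, mul_one, mul_smul_comm, smul_smul,
      ← mul_assoc, show z * c * u = c * (z * u) by ring]
  have h2 : (c * (z * u)) • (R * x * p) = (c * m) • (R * p - p) := by
    rw [hz, show c * (w * m) = c * m * w by ring, ← smul_smul (c * m) w, ← smul_mul_assoc, hR,
      sub_mul, one_mul]
  have h3 : c • ((R - m • (1 : B)) * (p - d • (1 : B))) =
      c • (R * p) - (c * d) • R - (c * m) • p + (c * d * m) • (1 : B) := by
    simp only [sub_mul, mul_sub, smul_mul_assoc, mul_smul_comm, one_mul, mul_one]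
    module
  rw [h1, h2, h3, hcd, hu]
  module

/-- With `W` the inverse of the factorized element, `m T(W) = 1` and `Y = F W R`. By traciality
`T(Y) = T(R F W)`; expanding `R F` in centered terms, only `m² T(W) = m` survives. -/
theorem compression_functional {S B : Type*} [CommRing S] [Ring B] [Algebra S B]
    (T : B →ₗ[S] S) (hT : ∀ a b, T (a * b) = T (b * a)) {R R' x p Y F' : B}
    {w m u z c d : S} (hp : p * p = p) (hR : w • (R * x) = R - 1) (hR' : R' * R = 1)
    (hR'' : R * R' = 1) (hz : z * u = w * m)
    (hu : u = 1 + c * (m - 1)) (hcd : c * d = 1) (hF : ((1 - p) + u • p) * F' = 1)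
    (hY : (1 - (z * c) • (x * p)) * Y = 1) (hT1 : T 1 = 1)
    (hvan : ∀ W : B, (m • (1 : B) - c • ((R - m • (1 : B)) * (p - d • (1 : B)))) * W = 1 →
      T ((p - d • (1 : B)) * W) = 0 ∧ T ((R - m • (1 : B)) * W) = 0 ∧
      T ((R - m • (1 : B)) * (p - d • (1 : B)) * W) = 0) :
    T Y = m := by
  set F := (1 - p) + u • p with hFdef
  have hW : (m • (1 : B) - c • ((R - m • (1 : B)) * (p - d • (1 : B)))) * (F' * Y * R') = 1 := by
    rw [← resolvent_factorization hp hR hz hu hcd, ← hFdef]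
    calc R * (1 - (z * c) • (x * p)) * F * (F' * Y * R')
        = R * ((1 - (z * c) • (x * p)) * ((F * F') * Y)) * R' := by simp only [mul_assoc]
      _ = 1 := by rw [hF, one_mul, hY, mul_one, hR'']
  obtain ⟨v1, v2, v3⟩ := hvan _ hW
  set W := F' * Y * R' with hWdef
  have hm : m * T W = 1 := by
    have := congrArg T hW
    rw [sub_mul, smul_mul_assoc, smul_mul_assoc, one_mul, map_sub, map_smul, map_smul, v3, hT1,
      smul_zero, sub_zero] at this
    exact this
  have hYW : Y = F * W * R := by
    rw [hWdef]
    calc Y = (F * F') * Y * (R' * R) := by rw [hF, hR', one_mul, mul_one]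
      _ = _ := by simp only [mul_assoc]
  have hRF : R * F = (m * m) • (1 : B) + (m * (u - 1)) • (p - d • (1 : B)) + m • (R - m • (1 : B)) +
      (u - 1) • ((R - m • (1 : B)) * (p - d • (1 : B))) := by
    have hud : d * (u - 1) = m - 1 := by
      rw [hu]
      linear_combination (m - 1) * hcd
    have hF2 : F = m • (1 : B) + (u - 1) • (p - d • (1 : B)) := by
      rw [hFdef, smul_sub, smul_smul, mul_comm, hud]
      module
    rw [hF2]
    simp only [sub_mul, mul_sub, mul_add, smul_mul_assoc, mul_smul_comm, one_mul, mul_one]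
    module
  rw [hYW, mul_assoc, hT, mul_assoc, hT, hRF, add_mul, add_mul, add_mul]
  simp only [smul_mul_assoc, one_mul, map_add, map_smul, v1, v2, v3,
    smul_eq_mul]
  linear_combination m * hm

end Compression

/-! ### Alternating words and vanishing traces. -/

section Freeness

variable {A : Type*} [CStarAlgebra A] {φ : A →ₗ[ℂ] ℂ}

theorem AreFreeSubalgebras.map_prod_eq_zero {I : Type*} {B : I → Subalgebra ℂ A}
    (h : AreFreeSubalgebras φ B) {l : List (I × A)} (hl : l ≠ [])
    (hB : ∀ q ∈ l, q.2 ∈ B q.1 ∧ φ q.2 = 0) (hc : l.IsChain fun q r => q.1 ≠ r.1) :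
    φ (l.map Prod.snd).prod = 0 := by
  obtain ⟨n, hn⟩ : ∃ n, l.length = n + 1 :=
    Nat.exists_eq_succ_of_ne_zero (by simpa [List.length_eq_zero_iff] using hl)
  have key := h n (fun i => (l.get (i.cast hn.symm)).1) (fun i => (l.get (i.cast hn.symm)).2)
    (fun i => (hB _ (List.get_mem _ _)).1) (fun i => (hB _ (List.get_mem _ _)).2)
    (fun i => List.isChain_iff_getElem.1 hc i (by omega))
  convert key using 3
  apply List.ext_get
  · simp [hn]
  · intro i h1 h2
    simp [-List.ofFn_succ]

/-- The real part of a linear functional. -/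
noncomputable def reFunctional (φ : A →ₗ[ℂ] ℂ) : A →ₗ[ℝ] ℝ :=
  Complex.reLm ∘ₗ φ.restrictScalars ℝ

theorem reFunctional_apply (a : A) : reFunctional φ a = (φ a).re := rfl

namespace TNormModel

variable {k : ℕ} {t : ℝ} (M : TNormModel φ k t)

/-- The products `y₁ p° y₂ p° ⋯` with `p° = p - t`. -/
noncomputable def word (ys : List (Fin k → ℝ)) : A :=
  (ys.map fun y => M.embed y * (M.proj - t • (1 : A))).prod

theorem word_cons (y : Fin k → ℝ) (ys : List (Fin k → ℝ)) :
    M.word (y :: ys) = M.embed y * (M.proj - t • (1 : A)) * M.word ys := by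
  simp [word]

/-- The letters of a word with the subalgebras to which they belong. -/
noncomputable def letters (ys : List (Fin k → ℝ)) : List (Fin 2 × A) :=
  ys.flatMap fun y => [(0, M.embed y), (1, M.proj - t • (1 : A))]

theorem prod_letters (ys : List (Fin k → ℝ)) :
    ((M.letters ys).map Prod.snd).prod = M.word ys := by
  induction ys with
  | nil => simp [letters, word]
  | cons y ys ih =>
    rw [word_cons, ← ih]
    simp [letters, mul_assoc]

theorem isChain_letters (a : A) (ys : List (Fin k → ℝ)) :
    (((1 : Fin 2), a) :: M.letters ys).IsChain fun q r => q.1 ≠ r.1 := by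
  induction ys generalizing a with
  | nil => simp [letters]
  | cons y ys ih =>
    have h := ih (M.proj - t • (1 : A))
    simp only [letters, List.flatMap_cons, List.cons_append, List.nil_append] at h ⊢
    exact List.isChain_cons_cons.2 ⟨by simp, List.isChain_cons_cons.2 ⟨by simp, h⟩⟩

theorem trace_centered_proj : φ (M.proj - t • (1 : A)) = 0 := by
  rw [map_sub, M.trace_proj, ← Complex.coe_smul, map_smul, M.isState.map_one]
  simp

theorem trace_embed_eq_zero {y : Fin k → ℝ} (hy : ∑ i, y i = 0) : φ (M.embed y) = 0 := by
  rw [M.trace_embed, hy]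
  simp

theorem embed_mem (y : Fin k → ℝ) :
    M.embed y ∈ Algebra.adjoin ℂ ((![Set.range M.embed, {M.proj}] : Fin 2 → Set A) 0) :=
  Algebra.subset_adjoin ⟨y, rfl⟩

theorem centered_proj_mem :
    M.proj - t • (1 : A) ∈
      Algebra.adjoin ℂ ((![Set.range M.embed, {M.proj}] : Fin 2 → Set A) 1) := by
  refine Subalgebra.sub_mem _ (Algebra.subset_adjoin rfl) ?_
  rw [← Complex.coe_smul]
  exact Subalgebra.smul_mem _ (Subalgebra.one_mem _) _

theorem letters_mem {ys : List (Fin k → ℝ)} (hys : ∀ y ∈ ys, ∑ i, y i = 0) :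
    ∀ q ∈ M.letters ys,
      q.2 ∈ Algebra.adjoin ℂ ((![Set.range M.embed, {M.proj}] : Fin 2 → Set A) q.1) ∧
        φ q.2 = 0 := by
  intro q hq
  simp only [letters, List.mem_flatMap, List.mem_cons, List.not_mem_nil, or_false] at hq
  obtain ⟨y, hy, rfl | rfl⟩ := hq
  · exact ⟨M.embed_mem y, M.trace_embed_eq_zero (hys y hy)⟩
  · exact ⟨M.centered_proj_mem, M.trace_centered_proj⟩

theorem trace_proj_mul_word {ys : List (Fin k → ℝ)} (hys : ∀ y ∈ ys, ∑ i, y i = 0) :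
    φ ((M.proj - t • (1 : A)) * M.word ys) = 0 := by
  have h := AreFreeSubalgebras.map_prod_eq_zero M.free
    (l := (1, M.proj - t • (1 : A)) :: M.letters ys) (List.cons_ne_nil _ _)
    (List.forall_mem_cons.2 ⟨⟨M.centered_proj_mem, M.trace_centered_proj⟩, M.letters_mem hys⟩)
    (M.isChain_letters _ ys)
  rwa [List.map_cons, List.prod_cons, M.prod_letters] at h

theorem trace_embed_mul_proj_mul_word {y : Fin k → ℝ} (hy : ∑ i, y i = 0)
    {ys : List (Fin k → ℝ)} (hys : ∀ y ∈ ys, ∑ i, y i = 0) :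
    φ (M.embed y * (M.proj - t • (1 : A)) * M.word ys) = 0 := by
  have h := AreFreeSubalgebras.map_prod_eq_zero M.free
    (l := M.letters (y :: ys)) (by simp [letters])
    (M.letters_mem (List.forall_mem_cons.2 ⟨hy, hys⟩))
    -- The leading `0` is a dummy letter, dropped at once.
    (List.isChain_of_isChain_cons (M.isChain_letters 0 (y :: ys)))
  rwa [M.prod_letters, M.word_cons] at h

theorem trace_embed_mul_word (hk : 1 ≤ k) {y : Fin k → ℝ} (hy : ∑ i, y i = 0)
    {ys : List (Fin k → ℝ)} (hys : ∀ y ∈ ys, ∑ i, y i = 0) :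
    φ (M.embed y * M.word ys) = 0 := by
  rcases ys with - | ⟨z, ys⟩
  · simpa [word] using M.trace_embed_eq_zero hy
  · obtain ⟨hz, hys⟩ := List.forall_mem_cons.1 hys
    -- The adjacent factors `y` and `z` merge, and `c` is the trace of `y z`. Both the centered part
    -- of `y z` and the scalar `c` leave an alternating word.
    set c : ℝ := (∑ i, y i * z i) / k with hc
    have hk' : (k : ℝ) ≠ 0 := by positivity
    have hsum : ∑ i, (y * z - c • (1 : Fin k → ℝ)) i = 0 := by
      simp [Finset.sum_sub_distrib, hc]
      field_simp
      simp
    have hsplit : M.embed y * M.embed z = M.embed (y * z - c • (1 : Fin k → ℝ)) + c • (1 : A) := by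
      rw [map_sub, map_mul, map_smul, map_one, sub_add_cancel]
    rw [word_cons, ← mul_assoc, ← mul_assoc, hsplit, add_mul, add_mul, map_add,
      M.trace_embed_mul_proj_mul_word hsum hys, smul_mul_assoc, one_mul, smul_mul_assoc,
      ← Complex.coe_smul, map_smul, M.trace_proj_mul_word hys]
    simp

/-- The span of the products `y₁ p° y₂ p° ⋯` of centered elements. -/
noncomputable def wordSpan : Submodule ℝ A :=
  Submodule.span ℝ {a | ∃ ys : List (Fin k → ℝ), (∀ y ∈ ys, ∑ i, y i = 0) ∧ a = M.word ys}

theorem one_mem_wordSpan : (1 : A) ∈ M.wordSpan :=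
  Submodule.subset_span ⟨[], by simp, by simp [word]⟩

theorem mul_mem_wordSpan {y : Fin k → ℝ} (hy : ∑ i, y i = 0) {v : A} (hv : v ∈ M.wordSpan) :
    M.embed y * (M.proj - t • (1 : A)) * v ∈ M.wordSpan := by
  induction hv using Submodule.span_induction with
  | mem v hv =>
    obtain ⟨ys, hys, rfl⟩ := hv
    exact Submodule.subset_span ⟨y :: ys, List.forall_mem_cons.2 ⟨hy, hys⟩, (M.word_cons y ys).symm⟩
  | zero => simp
  | add v w _ _ hv hw =>
    rw [mul_add]
    exact Submodule.add_mem _ hv hw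
  | smul c v _ hv =>
    rw [mul_smul_comm]
    exact Submodule.smul_mem _ _ hv

theorem reFunctional_mul_eq_zero_of_word {b : A}
    (hb : ∀ ys : List (Fin k → ℝ), (∀ y ∈ ys, ∑ i, y i = 0) → φ (b * M.word ys) = 0) {v : A}
    (hv : v ∈ M.wordSpan) : reFunctional φ (b * v) = 0 := by
  induction hv using Submodule.span_induction with
  | mem v hv =>
    obtain ⟨ys, hys, rfl⟩ := hv
    rw [reFunctional_apply, hb ys hys, Complex.zero_re]
  | zero => simp
  | add v w _ _ hv hw => rw [mul_add, map_add, hv, hw, add_zero]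
  | smul c v _ hv => rw [mul_smul_comm, map_smul, hv, smul_zero]

end TNormModel

end Freeness

/-! ### Free cumulants of the compression. -/

section Subordination

open PowerSeries

theorem X_series_smul {A : Type*} [Ring A] [Algebra ℝ A] (Y : PowerSeries A) :
    (X : PowerSeries ℝ) • Y = X * Y := by
  rw [Algebra.smul_def]
  exact congrArg (· * Y) (PowerSeries.map_X (algebraMap ℝ A))

theorem C_series_smul {A : Type*} [Ring A] [Algebra ℝ A] (c : ℝ) (Y : PowerSeries A) :
    (C c : PowerSeries ℝ) • Y = C (algebraMap ℝ A c) * Y := by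
  rw [Algebra.smul_def]
  exact congrArg (· * Y) (PowerSeries.map_C (algebraMap ℝ A) c)

variable {A : Type*} [CStarAlgebra A] {φ : A →ₗ[ℂ] ℂ}

/-- The moments of the uniform distribution on the coordinates. -/
noncomputable def coordMoment {k : ℕ} (x : Fin k → ℝ) (n : ℕ) : ℝ := (∑ i, x i ^ n) / k

theorem coordMoment_zero {k : ℕ} (hk : 1 ≤ k) (x : Fin k → ℝ) : coordMoment x 0 = 1 := by
  have : (k : ℝ) ≠ 0 := by positivity
  simp [coordMoment, this]

namespace IsFaithfulTracialState

theorem reFunctional_mul_comm (hφ : IsFaithfulTracialState φ) (a b : A) :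
    reFunctional φ (a * b) = reFunctional φ (b * a) := by
  rw [reFunctional_apply, reFunctional_apply, hφ.tracial]

theorem reFunctional_one (hφ : IsFaithfulTracialState φ) : reFunctional φ (1 : A) = 1 := by
  rw [reFunctional_apply, hφ.map_one, Complex.one_re]

end IsFaithfulTracialState

namespace TNormModel

variable {k : ℕ} {t : ℝ} (M : TNormModel φ k t)

/-- Free compression: the moment series of `x p / t` is subordinate to that of `x`. -/
theorem subst_compression (hk : 1 ≤ k) (ht : 0 < t) (x : Fin k → ℝ) {u : PowerSeries ℝ}
    (hu : u = 1 + C t⁻¹ * (PowerSeries.mk (coordMoment x) - 1)) :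
    (PowerSeries.mk fun n => reFunctional φ ((t⁻¹ • (M.embed x * M.proj)) ^ n)).subst
      (X * (PowerSeries.mk (coordMoment x) * u⁻¹)) = PowerSeries.mk (coordMoment x) := by
  have hm0 : constantCoeff (PowerSeries.mk (coordMoment x)) = 1 := by
    rw [← coeff_zero_eq_constantCoeff_apply, coeff_mk, coordMoment_zero hk]
  have hu0 : constantCoeff u ≠ 0 := by simp [hu, hm0]
  have hcd : (C t⁻¹ * C t : PowerSeries ℝ) = 1 := by
    rw [← map_mul, inv_mul_cancel₀ ht.ne', map_one]
  have hpp : M.proj * M.proj = M.proj := M.isStarProjection_proj.isIdempotentElem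
  -- The resolvent `(1 - X x)⁻¹`, whose trace is the moment series of `x`.
  set R : PowerSeries A := PowerSeries.mk fun n => M.embed (x ^ n) with hRdef
  have hR : (X : PowerSeries ℝ) • (R * C (M.embed x)) = R - 1 := by
    rw [X_series_smul, eq_sub_iff_add_eq]
    ext n
    rcases n with - | n
    · simp [hRdef]
    · simp [hRdef, coeff_succ_X_mul, coeff_mul_C, coeff_one, pow_succ]
  have hR1 : C (M.embed x) * R = R * C (M.embed x) := by
    ext n
    rw [coeff_C_mul, coeff_mul_C, hRdef, coeff_mk, ← map_mul, ← map_mul, mul_comm]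
  have hp0 : (C M.proj - (C t : PowerSeries ℝ) • (1 : PowerSeries A)) =
      C (M.proj - t • (1 : A)) := by
    rw [C_series_smul, mul_one, ← map_sub, Algebra.algebraMap_eq_smul_one]
  have hcoeff : ∀ n, coeff n (R - PowerSeries.mk (coordMoment x) • (1 : PowerSeries A)) =
      M.embed (x ^ n - coordMoment x n • (1 : Fin k → ℝ)) := by
    intro n
    rw [map_sub, map_sub, hRdef, coeff_mk, coeff_series_smul, map_smul, map_one]
    congr 1
    rw [Finset.sum_eq_single (n, 0)]
    · simp
    · intro ij hij hne
      have := Finset.HasAntidiagonal.mem_antidiagonal.1 hij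
      rw [coeff_one, if_neg, smul_zero]
      rintro h
      exact hne (Prod.ext (by simp; omega) h)
    · intro h
      exact absurd (Finset.HasAntidiagonal.mem_antidiagonal.2 (by simp)) h
  have hsum : ∀ n, ∑ i, (x ^ n - coordMoment x n • (1 : Fin k → ℝ)) i = 0 := by
    intro n
    have hk' : (k : ℝ) ≠ 0 := by positivity
    simp [Finset.sum_sub_distrib, coordMoment]
    field_simp
    simp
  have hY := geometricSeries_spec (PowerSeries.mk (coordMoment x) * u⁻¹) (t⁻¹ • (M.embed x * M.proj))
  rw [← seriesFunctional_geometricSeries]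
  refine compression_functional (R := R) (R' := 1 - (X : PowerSeries ℝ) • C (M.embed x))
    (x := C (M.embed x)) (p := C M.proj) (w := X) (z := X * (PowerSeries.mk (coordMoment x) * u⁻¹)) (u := u)
    (c := C t⁻¹) (d := C t) (F' := (1 - C M.proj) + u⁻¹ • C M.proj)
    (seriesFunctional (reFunctional φ))
    (seriesFunctional_mul_comm M.isState.reFunctional_mul_comm) ?_ hR ?_ ?_ ?_ hu hcd ?_ ?_ ?_ ?_
  · rw [← map_mul, hpp]
  · rw [sub_mul, one_mul, smul_mul_assoc, hR1, hR, sub_sub_cancel]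
  · rw [mul_sub, mul_one, mul_smul_comm, hR, sub_sub_cancel]
  · rw [mul_assoc, mul_assoc, PowerSeries.inv_mul_cancel _ hu0, mul_one]
  · have hCp : (C M.proj : PowerSeries A) * C M.proj = C M.proj := by rw [← map_mul, hpp]
    have e1 : (1 - C M.proj : PowerSeries A) * (1 - C M.proj) = 1 - C M.proj := by
      rw [mul_sub, sub_mul, sub_mul, one_mul, mul_one, one_mul, hCp, sub_self, sub_zero]
    have e2 : (1 - C M.proj : PowerSeries A) * C M.proj = 0 := by
      rw [sub_mul, one_mul, hCp, sub_self]
    have e3 : C M.proj * (1 - C M.proj : PowerSeries A) = 0 := by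
      rw [mul_sub, mul_one, hCp, sub_self]
    rw [add_mul, mul_add, mul_add, e1, mul_smul_comm, e2, smul_mul_assoc, e3, smul_mul_assoc,
      mul_smul_comm, hCp, smul_smul, PowerSeries.mul_inv_cancel _ hu0, one_smul]
    simp
  · convert hY using 3
    rw [← smul_smul, C_series_smul, ← map_mul, ← map_mul, ← Algebra.smul_def]
  · ext n
    rw [coeff_seriesFunctional, coeff_one, coeff_one]
    split_ifs
    · exact M.isState.reFunctional_one
    · exact map_zero _
  · intro W hW
    rw [hp0] at hW ⊢
    have hWV : ∀ n, coeff n W ∈ M.wordSpan := by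
      refine coeff_mem_of_mul_eq_one M.one_mem_wordSpan hm0 ?_ ?_ hW
      -- The constant term vanishes because `x ^ 0` minus its mean is `0`.
      · rw [C_series_smul, coeff_C_mul, coeff_mul_C, hcoeff]
        simp [coordMoment_zero hk]
      · intro n v hv
        rw [C_series_smul, coeff_C_mul, coeff_mul_C, hcoeff, ← Algebra.smul_def, smul_mul_assoc]
        exact Submodule.smul_mem _ _ (M.mul_mem_wordSpan (hsum n) hv)
    refine ⟨seriesFunctional_mul_eq_zero hWV fun n v hv => ?_,
      seriesFunctional_mul_eq_zero hWV fun n v hv => ?_,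
      seriesFunctional_mul_eq_zero hWV fun n v hv => ?_⟩
    · rw [coeff_C]
      split_ifs
      · exact M.reFunctional_mul_eq_zero_of_word (fun ys hys => M.trace_proj_mul_word hys) hv
      · rw [zero_mul, map_zero]
    · rw [hcoeff]
      exact M.reFunctional_mul_eq_zero_of_word
        (fun ys hys => M.trace_embed_mul_word hk (hsum n) hys) hv
    · rw [coeff_mul_C, hcoeff]
      exact M.reFunctional_mul_eq_zero_of_word
        (fun ys hys => M.trace_embed_mul_proj_mul_word (hsum n) hys) hv

/-- The moments of `p x p / t` in the compressed state. -/
noncomputable def compressedMoment (x : Fin k → ℝ) (n : ℕ) : ℝ :=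
  t⁻¹ * reFunctional φ (M.proj * (t⁻¹ • (M.proj * M.embed x * M.proj)) ^ n)

theorem reFunctional_proj : reFunctional φ M.proj = t := by
  rw [reFunctional_apply, M.trace_proj, Complex.ofReal_re]

theorem compressedMoment_zero (ht : 0 < t) (x : Fin k → ℝ) : M.compressedMoment x 0 = 1 := by
  rw [compressedMoment, pow_zero, mul_one, M.reFunctional_proj, inv_mul_cancel₀ ht.ne']

theorem compressedMoment_succ (x : Fin k → ℝ) (n : ℕ) :
    M.compressedMoment x (n + 1) =
      t⁻¹ * reFunctional φ ((t⁻¹ • (M.embed x * M.proj)) ^ (n + 1)) := by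
  have hpp : M.proj * M.proj = M.proj := M.isStarProjection_proj.isIdempotentElem
  have h : ∀ n, (M.proj * M.embed x * M.proj) ^ (n + 1) =
      M.proj * (M.embed x * M.proj) ^ (n + 1) := by
    intro n
    induction n with
    | zero => simp [mul_assoc]
    | succ n ih =>
      rw [pow_succ, ih, pow_succ _ (n + 1), pow_succ _ n]
      simp only [mul_assoc, ← mul_assoc M.proj M.proj, hpp]
  rw [compressedMoment, smul_pow, smul_pow, h, mul_smul_comm, map_smul, map_smul, ← mul_assoc, hpp,
    M.isState.reFunctional_mul_comm, pow_succ (M.embed x * M.proj), mul_assoc, mul_assoc, hpp]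

/-- The free cumulants of the free compression. -/
theorem freeCumulant_compressedMoment (hk : 1 ≤ k) (ht : 0 < t) (x : Fin k → ℝ) {r : ℕ}
    (hr : 1 ≤ r) :
    freeCumulant (M.compressedMoment x) r = 1 / t * freeCumulant (coordMoment x) r := by
  set u : PowerSeries ℝ := 1 + C t⁻¹ * (PowerSeries.mk (coordMoment x) - 1) with hu
  refine freeCumulant_of_subst_eq (coordMoment_zero hk x) (M.compressedMoment_zero ht x) hu ?_ r hr
  have hsub : HasSubst (X * (PowerSeries.mk (coordMoment x) * u⁻¹)) :=
    HasSubst.of_constantCoeff_zero' (by simp)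
  -- In positive degree the compressed moments are `1 / t` times those of `x p / t`, but both series
  -- start with `1`. So substitution yields `1 + (m - 1) / t = u`.
  have hmk : PowerSeries.mk (M.compressedMoment x) =
      C (1 : ℝ) + C t⁻¹ *
        ((PowerSeries.mk fun n => reFunctional φ ((t⁻¹ • (M.embed x * M.proj)) ^ n)) - C 1) := by
    ext n
    rcases n with - | n
    · simp [M.compressedMoment_zero ht, M.isState.reFunctional_one]
    · simp [M.compressedMoment_succ, coeff_one]
  have hC : ∀ c : ℝ, (C c).subst (X * (PowerSeries.mk (coordMoment x) * u⁻¹)) = C c := fun c => subst_C c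
  rw [mul_assoc, hmk, subst_add hsub, subst_mul hsub, subst_sub hsub, hC, hC,
    M.subst_compression hk ht x hu, hu]
  simp

end TNormModel

end Subordination

/-! ### Norms from moments, and spectral shifts in a corner. -/

section Norm

/-- If `C < r`, then `δ ≤ K (C / r) ^ (2 n)` tends to `0`. -/
theorem le_of_forall_pow_mul_le {r C δ K : ℝ} (hδ : 0 < δ) (hC : 0 ≤ C)
    (h : ∀ n : ℕ, 1 ≤ n → r ^ (2 * n) * δ ≤ K * C ^ (2 * n)) : r ≤ C := by
  by_contra! hlt
  have hr0 : 0 < r := hC.trans_lt hlt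
  have hq : (C / r) ^ 2 < 1 := by
    rw [sq_lt_one_iff₀ (by positivity), div_lt_one hr0]
    exact hlt
  have hlim : Filter.Tendsto (fun n : ℕ => K * ((C / r) ^ 2) ^ n) Filter.atTop (nhds (K * 0)) :=
    (tendsto_pow_atTop_nhds_zero_of_lt_one (by positivity) hq).const_mul K
  have hle : δ ≤ K * 0 := by
    refine ge_of_tendsto hlim (Filter.eventually_atTop.2 ⟨1, fun n hn => ?_⟩)
    have := h n hn
    rw [← pow_mul, div_pow, ← mul_div_assoc, le_div_iff₀ (by positivity), mul_comm]
    exact this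
  linarith

variable {A : Type*} [CStarAlgebra A] {φ : A →ₗ[ℂ] ℂ}

namespace IsFaithfulTracialState

theorem reFunctional_star_mul_self_nonneg (hφ : IsFaithfulTracialState φ) (a : A) :
    0 ≤ reFunctional φ (star a * a) :=
  (Complex.nonneg_iff.1 (hφ.nonneg a)).1

theorem eq_zero_of_reFunctional_star_mul_self (hφ : IsFaithfulTracialState φ) {a : A}
    (h : reFunctional φ (star a * a) = 0) : a = 0 :=
  hφ.faithful a (Complex.ext h (Complex.nonneg_iff.1 (hφ.nonneg a)).2.symm)

/-- Traciality alone exhibits `φ(p f(a))` as the trace of a positive element; `p` and `a` need not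
commute. -/
theorem reFunctional_proj_mul_cfc (hφ : IsFaithfulTracialState φ) {p : A} (hp : IsStarProjection p)
    {a : A} {f g : ℝ → ℝ} (hg : ContinuousOn g (spectrum ℝ a))
    (hfg : ∀ u ∈ spectrum ℝ a, f u = g u * g u) :
    reFunctional φ (p * cfc f a) = reFunctional φ (star (cfc g a * p) * (cfc g a * p)) := by
  have hsa : star (cfc g a) = cfc g a := (cfc_predicate g a : IsSelfAdjoint (cfc g a))
  have hps : star p = p := hp.isSelfAdjoint
  have hpp : p * p = p := hp.isIdempotentElem
  rw [star_mul, hsa, hps, cfc_congr hfg, cfc_mul g g a hg hg, ← mul_assoc (p * cfc g a),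
    hφ.reFunctional_mul_comm (p * cfc g a * cfc g a) p]
  simp only [← mul_assoc, hpp]

theorem reFunctional_proj_mul_cfc_nonneg (hφ : IsFaithfulTracialState φ) {p : A}
    (hp : IsStarProjection p) {a : A} {f : ℝ → ℝ}
    (hf : ContinuousOn f (spectrum ℝ a)) (h0 : ∀ u ∈ spectrum ℝ a, 0 ≤ f u) :
    0 ≤ reFunctional φ (p * cfc f a) := by
  rw [hφ.reFunctional_proj_mul_cfc hp (g := fun u => √(f u)) hf.sqrt
    fun u hu => (Real.mul_self_sqrt (h0 u hu)).symm]
  exact hφ.reFunctional_star_mul_self_nonneg _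

theorem reFunctional_proj_mul_cfc_mono (hφ : IsFaithfulTracialState φ) {p : A}
    (hp : IsStarProjection p) {a : A} {f g : ℝ → ℝ}
    (hf : ContinuousOn f (spectrum ℝ a)) (hg : ContinuousOn g (spectrum ℝ a))
    (h : ∀ u ∈ spectrum ℝ a, f u ≤ g u) :
    reFunctional φ (p * cfc f a) ≤ reFunctional φ (p * cfc g a) := by
  have := hφ.reFunctional_proj_mul_cfc_nonneg hp (f := fun u => g u - f u)
    (hg.sub hf) fun u hu => sub_nonneg.2 (h u hu)
  rwa [cfc_sub g f a hg hf, mul_sub, map_sub, sub_nonneg] at this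

theorem _root_.abs_le_norm_of_mem_spectrum {a : A} {u : ℝ} (hu : u ∈ spectrum ℝ a) : |u| ≤ ‖a‖ := by
  have : Nontrivial A := by
    by_contra h
    rw [not_nontrivial_iff_subsingleton] at h
    simp [spectrum.of_subsingleton] at hu
  simpa using spectrum.norm_le_norm_of_mem hu

/-- Even moments in a compressed state are bounded by powers of the norm. -/
theorem reFunctional_proj_mul_pow_le (hφ : IsFaithfulTracialState φ) {p : A}
    (hp : IsStarProjection p) {a : A} (ha : IsSelfAdjoint a) (n : ℕ) :
    reFunctional φ (p * a ^ (2 * n)) ≤ reFunctional φ p * ‖a‖ ^ (2 * n) := by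
  have h := hφ.reFunctional_proj_mul_cfc_mono hp (f := fun u => u ^ (2 * n))
    (g := fun _ => ‖a‖ ^ (2 * n)) (by fun_prop) (by fun_prop) fun u hu => by
      rw [pow_mul, pow_mul]
      exact pow_le_pow_left₀ (sq_nonneg u)
        (sq_le_sq.2 ((abs_le_norm_of_mem_spectrum hu).trans (le_abs_self _))) n
  rw [cfc_pow_id a, cfc_const _ a, Algebra.algebraMap_eq_smul_one, mul_smul_comm, mul_one,
    map_smul, smul_eq_mul] at h
  linarith

/-- The norm of a self-adjoint element of a compressed algebra is bounded by the growth of its even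
moments. -/
theorem norm_le_of_moments_le (hφ : IsFaithfulTracialState φ) {p : A}
    (hp : IsStarProjection p) {a : A} (ha : IsSelfAdjoint a) (hpa : p * a = a) {C K : ℝ}
    (hC : 0 ≤ C) (h : ∀ n : ℕ, 1 ≤ n → reFunctional φ (p * a ^ (2 * n)) ≤ K * C ^ (2 * n)) :
    ‖a‖ ≤ C := by
  refine le_of_forall_gt_imp_ge_of_dense fun r hr => ?_
  by_contra! hCr
  have : Nontrivial A := by
    by_contra hA
    rw [not_nontrivial_iff_subsingleton] at hA
    have : ‖a‖ = 0 := by rw [Subsingleton.elim a 0, norm_zero]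
    linarith
  -- A bump living on `|u| > r`, where `C < r < ‖a‖`. If `φ(p g(a)²)` vanished, faithfulness would
  -- give `g(a) p = 0`, hence `g(a) a = g(a) p a = 0`, contradicting that `‖a‖` or `-‖a‖` is in the
  -- spectrum.
  set g : ℝ → ℝ := fun u => max (|u| - r) 0 with hg
  have hgc : Continuous g := by fun_prop
  have hr0 : 0 < r := hC.trans_lt hr
  have ha0 : 0 < ‖a‖ := hr0.trans hCr
  have hpos : 0 < reFunctional φ (p * cfc (fun u => g u * g u) a) := by
    refine lt_of_le_of_ne (hφ.reFunctional_proj_mul_cfc_nonneg hp (by fun_prop)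
      fun u _ => mul_self_nonneg _) fun h0 => ?_
    rw [hφ.reFunctional_proj_mul_cfc hp hgc.continuousOn fun u _ => rfl] at h0
    have h1 : cfc g a * p = 0 := hφ.eq_zero_of_reFunctional_star_mul_self h0.symm
    have h2 : cfc (fun u => g u * u) a = 0 := by
      rw [cfc_mul g (fun u => u) a hgc.continuousOn (by fun_prop), cfc_id' ℝ a, ← hpa, ← mul_assoc,
        hpa, h1, zero_mul]
    have h3 : ∀ u ∈ spectrum ℝ a, g u * u = 0 := by
      intro u hu
      have : g u * u ∈ spectrum ℝ (cfc (fun u => g u * u) a) := by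
        rw [cfc_map_spectrum (fun u => g u * u) a ha (by fun_prop)]
        exact ⟨u, hu, rfl⟩
      rw [h2, spectrum.zero_eq] at this
      exact this
    have h4 : ∀ u : ℝ, |u| = ‖a‖ → g u * u ≠ 0 := by
      intro u hu
      refine mul_ne_zero ?_ fun h => ?_
      · rw [hg]
        simp only [hu]
        exact (lt_max_of_lt_left (by linarith)).ne'
      · rw [h, abs_zero] at hu
        linarith
    rcases CStarAlgebra.norm_or_neg_norm_mem_spectrum ha with hm | hm
    · exact h4 _ (by simp) (h3 _ hm)
    · exact h4 _ (by simp) (h3 _ hm)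
  have hle : r ≤ C := by
    refine le_of_forall_pow_mul_le (K := K * ‖a‖ ^ 2) hpos hC fun n hn => ?_
    have h5 := hφ.reFunctional_proj_mul_cfc_mono hp (f := fun u => r ^ (2 * n) * (g u * g u))
      (g := fun u => ‖a‖ ^ 2 * u ^ (2 * n)) (by fun_prop) (by fun_prop) fun u hu => by
        have hua := abs_le_norm_of_mem_spectrum hu
        rcases le_total |u| r with hur | hur
        · have : g u = 0 := max_eq_right (by linarith)
          rw [this]
          have := pow_mul u 2 n ▸ pow_nonneg (sq_nonneg u) n
          nlinarith [sq_nonneg ‖a‖, mul_nonneg (sq_nonneg ‖a‖) this]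
        · have hgu : g u = |u| - r := max_eq_left (by linarith)
          have e1 : g u * g u ≤ ‖a‖ ^ 2 := by
            rw [hgu]
            nlinarith
          have e2 : r ^ (2 * n) ≤ u ^ (2 * n) := by
            rw [pow_mul, pow_mul, ← sq_abs u]
            exact pow_le_pow_left₀ (sq_nonneg r) (pow_le_pow_left₀ hr0.le hur 2) n
          calc r ^ (2 * n) * (g u * g u) ≤ u ^ (2 * n) * ‖a‖ ^ 2 :=
                mul_le_mul e2 e1 (mul_self_nonneg _) ((pow_nonneg hr0.le _).trans e2)
            _ = _ := mul_comm _ _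
    rw [cfc_const_mul _ (fun u => g u * g u) a (by fun_prop),
      cfc_const_mul _ (fun u => u ^ (2 * n)) a (by fun_prop), cfc_pow_id a, mul_smul_comm,
      mul_smul_comm, map_smul, map_smul, smul_eq_mul, smul_eq_mul] at h5
    have := mul_le_mul_of_nonneg_left (h n hn) (sq_nonneg ‖a‖)
    linarith
  linarith

end IsFaithfulTracialState

/-- Shifting by a multiple of the unit of a compressed algebra. -/
theorem norm_add_le_max_of_proj {p : A} (hp : IsStarProjection p) {a : A} (ha : IsSelfAdjoint a)
    (hpa : p * a = a) (ha0 : a ≠ 0) {s : ℝ} (hs : 0 ≤ s) :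
    ‖a‖ + s ≤ max ‖s • p + a‖ ‖s • p - a‖ := by
  have hap : a * p = a := by
    have := congrArg star hpa
    rwa [star_mul, ha.star_eq, hp.isSelfAdjoint.star_eq] at this
  have hpp : p * p = p := hp.isIdempotentElem
  have : Nontrivial A := ⟨a, 0, ha0⟩
  have key : ∀ b : A, p * b = b → b * p = b → ∀ c : ℝ, 0 < c → c ∈ spectrum ℝ b →
      c + s ≤ ‖s • p + b‖ := by
    intro b hpb hbp c hc hmem
    refine (le_abs_self _).trans (abs_le_norm_of_mem_spectrum ?_)
    rw [spectrum.mem_iff, Algebra.algebraMap_eq_smul_one] at hmem ⊢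
    contrapose! hmem
    have hcs : c + s ≠ 0 := by positivity
    -- On `1 - p` the elements `c - b` and `c + s - (s p + b)` act as `c` and `c + s`; the factor
    -- `d` corrects this, so invertibility transfers without passing to the corner.
    set d := c / (c + s) with hd
    have hfac : c • (1 : A) - b =
        ((c + s) • (1 : A) - (s • p + b)) * (p + d • (1 - p)) := by
      have hdc : (c + s) * d = c := mul_div_cancel₀ c hcs
      have e1 : ((c + s) • (1 : A) - (s • p + b)) * p = c • p - b := by
        rw [sub_mul, add_mul, smul_mul_assoc, smul_mul_assoc, one_mul, hpp, hbp]
        module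
      have e2 : ((c + s) • (1 : A) - (s • p + b)) * (1 - p) = (c + s) • (1 - p) := by
        rw [mul_sub, mul_one, e1]
        module
      rw [mul_add, mul_smul_comm, e1, e2, smul_smul, mul_comm d, hdc]
      module
    rw [hfac]
    refine hmem.mul ?_
    have hd0 : d ≠ 0 := by positivity
    have e1 : p * (1 - p) = 0 := by rw [mul_sub, mul_one, hpp, sub_self]
    have e2 : (1 - p) * p = 0 := by rw [sub_mul, one_mul, hpp, sub_self]
    have e3 : (1 - p) * (1 - p) = 1 - p := by rw [mul_sub, e2, mul_one, sub_zero]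
    have e4 : ∀ e f : ℝ, e * f = 1 → (p + e • (1 - p)) * (p + f • (1 - p)) = 1 := by
      intro e f hef
      rw [add_mul, mul_add, mul_add, mul_smul_comm, smul_mul_assoc, smul_mul_assoc, mul_smul_comm,
        hpp, e1, e2, e3, smul_smul, hef]
      simp
    exact ⟨⟨p + d • (1 - p), p + d⁻¹ • (1 - p), e4 _ _ (mul_inv_cancel₀ hd0),
      e4 _ _ (inv_mul_cancel₀ hd0)⟩, rfl⟩
  have hn : 0 < ‖a‖ := norm_pos_iff.2 ha0
  rcases CStarAlgebra.norm_or_neg_norm_mem_spectrum ha with hm | hm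
  · exact le_max_of_le_left (key a hpa hap _ hn hm)
  · refine le_max_of_le_right ?_
    rw [sub_eq_add_neg]
    refine key (-a) (by rw [mul_neg, hpa]) (by rw [neg_mul, hap]) _ hn ?_
    rw [← spectrum.neg_eq]
    simpa using hm

end Norm

/-! ### Moments and supports of measures on the line. -/

section Measures

open MeasureTheory

theorem integrable_of_isCompact_support {ν : Measure ℝ} [IsFiniteMeasure ν]
    (hν : IsCompact ν.support) {f : ℝ → ℝ} (hf : Continuous f) : Integrable f ν := by
  have h : ν.restrict ν.support = ν := Measure.restrict_eq_self_of_ae_mem Measure.support_mem_ae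
  rw [← h]
  exact hf.continuousOn.integrableOn_compact hν

theorem momentSeq_empiricalMeasure {k : ℕ} (x : Fin k → ℝ) :
    momentSeq (empiricalMeasure x) = coordMoment x := by
  funext n
  rw [momentSeq, empiricalMeasure, integral_smul_measure,
    integral_finsetSum_measure fun i _ => integrable_dirac (by simp)]
  simp [coordMoment, div_eq_inv_mul]

/-- A point of the support is bounded by the growth of the even moments. -/
theorem abs_le_of_mem_support {ν : Measure ℝ} [IsFiniteMeasure ν] (hν : IsCompact ν.support)
    {g : ℝ → ℝ} (hg : Continuous g) {C : ℝ} (hC : 0 ≤ C)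
    (h : ∀ n : ℕ, ∫ u, g u ^ (2 * n) ∂ν ≤ C ^ (2 * n)) {u₀ : ℝ} (hu₀ : u₀ ∈ ν.support) :
    |g u₀| ≤ C := by
  refine le_of_forall_lt_imp_le_of_dense fun r hr => ?_
  rcases lt_or_ge r 0 with hr0 | hr0
  · exact hr0.le.trans hC
  set U : Set ℝ := {u | r < |g u|} with hU
  have hUo : IsOpen U := isOpen_lt continuous_const hg.abs
  have hpos : 0 < ν.real U :=
    ENNReal.toReal_pos ((Measure.mem_support_iff_forall u₀).1 hu₀ U (hUo.mem_nhds hr)).ne'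
      (measure_ne_top _ _)
  refine le_of_forall_pow_mul_le (K := 1) hpos hC fun n _ => ?_
  have hint : Integrable (fun u => g u ^ (2 * n)) ν := integrable_of_isCompact_support hν (hg.pow _)
  calc r ^ (2 * n) * ν.real U ≤ ∫ u in U, g u ^ (2 * n) ∂ν := by
        refine setIntegral_ge_of_const_le_real hUo.measurableSet (measure_ne_top _ _) (fun u hu => ?_)
          hint.integrableOn
        rw [pow_mul, pow_mul, ← sq_abs (g u)]
        exact pow_le_pow_left₀ (sq_nonneg r) (pow_le_pow_left₀ hr0 (le_of_lt hu) 2) n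
    _ ≤ ∫ u, g u ^ (2 * n) ∂ν := by
        refine setIntegral_le_integral hint (Filter.Eventually.of_forall fun u => ?_)
        exact (even_two_mul n).pow_nonneg (g u)
    _ ≤ 1 * C ^ (2 * n) := by rw [one_mul]; exact h n

end Measures

/-! ### The distribution of a compression, by Riesz representation. -/

section CompressedDistribution

open MeasureTheory
open scoped CompactlySupported

variable {A : Type*} [CStarAlgebra A] {φ : A →ₗ[ℂ] ℂ}

/-- The positive functional `f ↦ c φ(p f(a))`. -/
noncomputable def cfcFunctional (hφ : IsFaithfulTracialState φ) {p : A} (hp : IsStarProjection p)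
    (a : A) {c : ℝ} (hc : 0 ≤ c) : C_c(ℝ, ℝ) →ₚ[ℝ] ℝ :=
  PositiveLinearMap.mk₀
    { toFun := fun f => c * reFunctional φ (p * cfc f a)
      map_add' := fun f g => by
        have : cfc (⇑(f + g)) a = cfc f a + cfc g a :=
          cfc_add a f g f.continuous.continuousOn g.continuous.continuousOn
        rw [this, mul_add, map_add, mul_add]
      map_smul' := fun r f => by
        have : cfc (⇑(r • f)) a = r • cfc f a := cfc_smul r f a f.continuous.continuousOn
        rw [this, mul_smul_comm, map_smul, smul_eq_mul, RingHom.id_apply, smul_eq_mul]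
        ring }
    fun f hf => mul_nonneg hc
      (hφ.reFunctional_proj_mul_cfc_nonneg hp f.continuous.continuousOn fun u _ => hf u)

/-- A self-adjoint element has a compactly supported distribution in a compressed state. -/
theorem exists_measure_moments (hφ : IsFaithfulTracialState φ) {p : A} (hp : IsStarProjection p)
    {a : A} (ha : IsSelfAdjoint a) {c : ℝ} (hc : 0 ≤ c) :
    ∃ ν : Measure ℝ, IsCompact ν.support ∧
      ∀ n : ℕ, ∫ u, u ^ n ∂ν = c * reFunctional φ (p * a ^ n) := by
  set Λ := cfcFunctional hφ hp a hc with hΛ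
  have hΛf : ∀ f : C_c(ℝ, ℝ), Λ f = c * reFunctional φ (p * cfc f a) := fun f => rfl
  set I : Set ℝ := Set.Icc (-‖a‖) ‖a‖ with hI
  have hspec : ∀ u ∈ spectrum ℝ a, u ∈ I := fun u hu =>
    abs_le.1 (abs_le_norm_of_mem_spectrum hu)
  set ν := RealRMK.rieszMeasure Λ with hν
  have hsupp : ν.support ⊆ I := by
    intro u hu
    by_contra huI
    obtain ⟨K, hK, huK, hKI⟩ : ∃ K : Set ℝ, IsCompact K ∧ u ∈ interior K ∧ K ⊆ Iᶜ :=
      exists_compact_subset isClosed_Icc.isOpen_compl huI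
    obtain ⟨f, hf1, hf2, hf3⟩ :=
      exists_continuousMap_one_of_isCompact_subset_isOpen hK isClosed_Icc.isOpen_compl hKI
    -- `F` is `1` on a neighbourhood of `u` and vanishes on the spectrum, so that neighbourhood is
    -- null.
    set F : C_c(ℝ, ℝ) := ⟨f, hasCompactSupport_def.mpr hf2⟩ with hF
    have hle := RealRMK.rieszMeasure_le_of_eq_one Λ (f := F) (fun v => (hf3.2 v).1) hK
      fun v hv => hf1 hv
    have hzero : cfc (⇑F) a = 0 := by
      rw [cfc_congr (g := fun _ => (0 : ℝ)) fun v hv => ?_, cfc_const_zero]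
      exact image_eq_zero_of_notMem_tsupport fun h => hf3.1 h (hspec v hv)
    rw [hΛf, hzero, mul_zero, map_zero, mul_zero, ENNReal.ofReal_zero] at hle
    have hpos := (Measure.mem_support_iff_forall u).1 hu K (mem_interior_iff_mem_nhds.1 huK)
    exact absurd hle (not_le.2 hpos)
  refine ⟨ν, isCompact_Icc.of_isClosed_subset Measure.isClosed_support hsupp, fun n => ?_⟩
  -- A cutoff equal to `1` on `I` makes the monomials admissible test functions.
  obtain ⟨f, hf1, hf2, -⟩ := exists_continuousMap_one_of_isCompact_subset_isOpen
    (isCompact_Icc : IsCompact I) isOpen_univ (Set.subset_univ _)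
  have hcs : HasCompactSupport fun u : ℝ => u ^ n * f u :=
    HasCompactSupport.mul_left (hasCompactSupport_def.mpr hf2)
  set F : C_c(ℝ, ℝ) := ⟨⟨fun u => u ^ n * f u, by fun_prop⟩, hcs⟩ with hF
  have hFI : ∀ u ∈ I, F u = u ^ n := fun u hu => by
    have : f u = 1 := hf1 hu
    simp [hF, this]
  have h1 : ∫ u, u ^ n ∂ν = ∫ u, F u ∂ν := by
    refine integral_congr_ae ?_
    filter_upwards [(Measure.support_mem_ae : ν.support ∈ ae ν)] with u hu
    exact (hFI u (hsupp hu)).symm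
  rw [h1, RealRMK.integral_rieszMeasure, hΛf, cfc_congr fun u hu => hFI u (hspec u hu),
    cfc_pow_id a]

end CompressedDistribution

/-! ### Identification with the free convolution power. -/

section FreePower

open MeasureTheory

variable {A : Type*} [CStarAlgebra A] {φ : A →ₗ[ℂ] ℂ}

namespace TNormModel

variable {k : ℕ} {t : ℝ} (M : TNormModel φ k t)

theorem isSelfAdjoint_embed (x : Fin k → ℝ) : IsSelfAdjoint (M.embed x) := by
  rw [isSelfAdjoint_iff, ← map_star]
  congr 1

theorem isSelfAdjoint_compression (x : Fin k → ℝ) :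
    IsSelfAdjoint (M.proj * M.embed x * M.proj) := by
  have hp : star M.proj = M.proj := M.isStarProjection_proj.isSelfAdjoint
  rw [isSelfAdjoint_iff, star_mul, star_mul, hp, (M.isSelfAdjoint_embed x).star_eq, mul_assoc]

theorem proj_mul_compression (x : Fin k → ℝ) :
    M.proj * (M.proj * M.embed x * M.proj) = M.proj * M.embed x * M.proj := by
  have hpp : M.proj * M.proj = M.proj := M.isStarProjection_proj.isIdempotentElem
  simp only [← mul_assoc, hpp]

/-- The free convolution power exists and is the distribution of `p x p / t` in the compressed
state. -/
theorem isFreeConvPower (M : TNormModel φ k t) (hk : 1 ≤ k) (ht : 0 < t) (x : Fin k → ℝ) :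
    IsFreeConvPower (1 / t) (empiricalMeasure x)
      (freeConvPower (1 / t) (empiricalMeasure x)) := by
  have hex : ∃ ν, IsFreeConvPower (1 / t) (empiricalMeasure x) ν := by
    obtain ⟨ν, hν, hm⟩ := exists_measure_moments M.isState M.isStarProjection_proj
      ((IsSelfAdjoint.all t⁻¹).smul (M.isSelfAdjoint_compression x)) (inv_nonneg.2 ht.le)
    have hmom : momentSeq ν = M.compressedMoment x := funext hm
    refine ⟨ν, ⟨?_⟩, hν, fun n hn => ?_⟩
    · have h0 := hm 0
      rw [← compressedMoment, M.compressedMoment_zero ht] at h0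
      simpa [Measure.real, ENNReal.toReal_eq_one_iff] using h0
    · rw [hmom, momentSeq_empiricalMeasure, M.freeCumulant_compressedMoment hk ht x hn]
  rw [freeConvPower, dif_pos hex]
  exact hex.choose_spec

/-- The measure comes from a choice and is known only through its cumulants, but these force its
moments. -/
theorem momentSeq_freeConvPower (hk : 1 ≤ k) (ht : 0 < t) (x : Fin k → ℝ) :
    momentSeq (freeConvPower (1 / t) (empiricalMeasure x)) = M.compressedMoment x := by
  have h := M.isFreeConvPower hk ht x
  have := h.isProbabilityMeasure
  refine eq_of_freeCumulant_eq ?_ fun r hr => ?_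
  · rw [M.compressedMoment_zero ht]
    simp only [momentSeq, pow_zero, integral_const, probReal_univ, smul_eq_mul, mul_one]
  · rw [h.freeCumulant_eq r hr, momentSeq_empiricalMeasure,
      M.freeCumulant_compressedMoment hk ht x hr]

/-- Points of the support of the free convolution power bound the `(t)`-norms of the shifts. -/
theorem abs_le_tNorm_of_mem_support (hk : 1 ≤ k) (ht : 0 < t) (x : Fin k → ℝ) (s : ℝ) {u : ℝ}
    (hu : u ∈ (freeConvPower (1 / t) (empiricalMeasure x)).support) :
    |t * u + s| ≤ M.tNorm fun i => x i + s := by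
  have h := M.isFreeConvPower hk ht x
  have hmom := M.momentSeq_freeConvPower hk ht x
  set ν := freeConvPower (1 / t) (empiricalMeasure x) with hν
  have := h.isProbabilityMeasure
  have hpp : M.proj * M.proj = M.proj := M.isStarProjection_proj.isIdempotentElem
  set a := M.proj * M.embed x * M.proj with ha
  set b := M.proj * M.embed (fun i => x i + s) * M.proj with hb
  have hba : b = M.proj * (a + s • (1 : A)) := by
    have hx : (fun i => x i + s) = x + s • (1 : Fin k → ℝ) := by
      ext i
      simp
    rw [hb, hx, map_add, map_smul, map_one, mul_add, add_mul, mul_add, mul_smul_comm, mul_one,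
      smul_mul_assoc, hpp, ha, M.proj_mul_compression]
  have hcomm : Commute M.proj (a + s • (1 : A)) := by
    refine Commute.add_right ?_ ((Commute.one_right _).smul_right s)
    rw [Commute, SemiconjBy, ha, M.proj_mul_compression, mul_assoc, mul_assoc, mul_assoc, hpp]
  -- Under `p`, powers of `b` agree with those of `a + s`, so even moments of `t u + s` are even
  -- moments of `b`.
  have hbn : ∀ n, M.proj * b ^ n = M.proj * (a + s • (1 : A)) ^ n := by
    intro n
    rcases n with - | n
    · simp
    · rw [hba, hcomm.mul_pow, M.isStarProjection_proj.isIdempotentElem.pow_succ_eq, ← mul_assoc,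
        hpp]
  have hpoly : ∀ P : Polynomial ℝ, ∫ u, P.eval (t * u) ∂ν =
      t⁻¹ * reFunctional φ (M.proj * Polynomial.aeval a P) := by
    intro P
    induction P using Polynomial.induction_on' with
    | add P Q hP hQ =>
      simp only [Polynomial.eval_add, map_add, mul_add]
      rw [integral_add, hP, hQ]
      · exact integrable_of_isCompact_support h.isCompact_support (by fun_prop)
      · exact integrable_of_isCompact_support h.isCompact_support (by fun_prop)
    | monomial n c =>
      have hn := congrFun hmom n
      rw [momentSeq, compressedMoment, smul_pow, mul_smul_comm, map_smul, smul_eq_mul] at hn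
      simp only [Polynomial.eval_monomial, mul_pow, integral_const_mul, hn,
        Polynomial.aeval_monomial, ← Algebra.smul_def, mul_smul_comm, map_smul, smul_eq_mul]
      rw [inv_pow, ← ha]
      field_simp
  refine abs_le_of_mem_support h.isCompact_support (g := fun u => t * u + s) (by fun_prop)
    (norm_nonneg _) (fun n => ?_) hu
  have h1 := hpoly ((Polynomial.X + Polynomial.C s) ^ (2 * n))
  have h2 := M.isState.reFunctional_proj_mul_pow_le M.isStarProjection_proj
    (M.isSelfAdjoint_compression fun i => x i + s) n
  rw [← hb, hbn, M.reFunctional_proj] at h2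
  simp only [Polynomial.eval_pow, Polynomial.eval_add, Polynomial.eval_X, Polynomial.eval_C,
    map_pow, map_add, Polynomial.aeval_X, Polynomial.aeval_C,
    Algebra.algebraMap_eq_smul_one] at h1
  change _ ≤ ‖b‖ ^ (2 * n)
  rw [h1, inv_mul_le_iff₀ ht]
  exact h2

end TNormModel

end FreePower

/-! ### Two projections with traces of sum greater than one. -/

section ProjectionPair

variable {A : Type*} [CStarAlgebra A] {φ : A →ₗ[ℂ] ℂ}

theorem IsFaithfulTracialState.not_isUnit_one_sub (hφ : IsFaithfulTracialState φ) {e p : A}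
    (he : IsStarProjection e) (hp : IsStarProjection p)
    (h : 1 < reFunctional φ e + reFunctional φ p) : ¬IsUnit (1 - e * p * e) := by
  rintro ⟨⟨b, c, hbc, hcb⟩, hb⟩
  change b = _ at hb
  have hee : e * e = e := he.isIdempotentElem
  have hes : star e = e := he.isSelfAdjoint
  have hqp := hp.one_sub
  set q := 1 - p with hq
  have hqq : q * q = q := hqp.isIdempotentElem
  have hqs : star q = q := hqp.isSelfAdjoint
  have hbe : b * e = e * q * e := by
    rw [hb, hq, sub_mul, one_mul, mul_assoc _ e e, hee, mul_sub, sub_mul, mul_one, hee]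
  have heb : e * b = e * q * e := by
    rw [hb, hq, mul_sub, mul_one, ← mul_assoc, ← mul_assoc, hee, mul_sub, sub_mul, mul_one, hee]
  have hec : e * c = c * e := by
    calc e * c = c * b * (e * c) := by rw [hcb, one_mul]
      _ = c * (b * e) * c := by simp only [mul_assoc]
      _ = c * e * (b * c) := by rw [hbe, ← heb]; simp only [mul_assoc]
      _ = c * e := by rw [hbc, mul_one]
  have hbs : star b = b := by
    rw [hb, star_sub, star_one, star_mul, star_mul, hes, hp.isSelfAdjoint.star_eq, mul_assoc]
  have hcs : star c = c := by
    have h1 : star c * b = 1 := by rw [← hbs, ← star_mul, hbc, star_one]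
    calc star c = star c * (b * c) := by rw [hbc, mul_one]
      _ = c := by rw [← mul_assoc, h1, one_mul]
  -- If `1 - e p e` had an inverse `c`, then `r` would be a projection below `q = 1 - p` with the
  -- trace of `e`, forcing `φ(e) ≤ 1 - φ(p)`.
  set r := q * e * c * (e * q) with hr
  have hrs : star r = r := by
    rw [hr]
    simp only [star_mul, hqs, hes, hcs, mul_assoc]
  have hqr : q * r = r := by simp only [hr, ← mul_assoc, hqq]
  have hrq : r * q = r := by simp only [hr, mul_assoc, hqq]
  have hrr : r * r = r := by
    calc r * r = q * e * c * (e * (q * q) * e) * c * (e * q) := by simp only [hr, mul_assoc]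
      _ = q * e * (c * b) * (e * c) * (e * q) := by
        rw [hqq, ← hbe]
        simp only [mul_assoc]
      _ = r := by
        rw [hcb, mul_one, ← mul_assoc (q * e), mul_assoc q e e, hee]
  have htr : reFunctional φ r = reFunctional φ e := by
    calc reFunctional φ r = reFunctional φ (c * (e * q) * (q * e)) := by
          rw [hr, mul_assoc (q * e), hφ.reFunctional_mul_comm]
      _ = reFunctional φ (c * (e * (q * q) * e)) := by simp only [mul_assoc]
      _ = reFunctional φ e := by rw [hqq, ← hbe, ← mul_assoc, hcb, one_mul]
  have hpos := hφ.reFunctional_star_mul_self_nonneg (q - r)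
  have hsq : star (q - r) * (q - r) = q - r := by
    rw [star_sub, hqs, hrs, sub_mul, mul_sub q q r, mul_sub r q r, hqq, hqr, hrq, hrr, sub_self, sub_zero]
  rw [hsq, map_sub, htr, hq, map_sub, hφ.reFunctional_one] at hpos
  linarith

/-- A spectral bump at `0` replaces a kernel projection, which a C*-algebra may not contain. -/
theorem exists_norm_mul_le_of_not_isUnit {b : A} (hb : IsSelfAdjoint b) (hu : ¬IsUnit b) {ε : ℝ}
    (hε : 0 < ε) : ∃ w : A, 0 < ‖w‖ ∧ ‖b * w‖ ≤ ε * ‖w‖ := by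
  set f : ℝ → ℝ := fun u => max (1 - |u| / ε) 0 with hf
  have hfc : Continuous f := by fun_prop
  have h0 : (0 : ℝ) ∈ spectrum ℝ b := spectrum.zero_mem_iff ℝ |>.2 hu
  have h1 : (1 : ℝ) ∈ spectrum ℝ (cfc f b) := by
    rw [cfc_map_spectrum f b hb hfc.continuousOn]
    exact ⟨0, h0, by simp [hf]⟩
  have hw : 1 ≤ ‖cfc f b‖ := by
    simpa using abs_le_norm_of_mem_spectrum h1
  refine ⟨cfc f b, by linarith, ?_⟩
  have h2 : b * cfc f b = cfc (fun u => u * f u) b := by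
    rw [cfc_mul (fun u => u) f b (by fun_prop) hfc.continuousOn, cfc_id' ℝ b]
  rw [h2]
  refine (norm_cfc_le hε.le fun u _ => ?_).trans (le_mul_of_one_le_right hε.le hw)
  have hf0 : 0 ≤ f u := le_max_right _ _
  have hf1 : f u ≤ 1 := max_le (by have : 0 ≤ |u| / ε := by positivity
                                   linarith) zero_le_one
  rw [Real.norm_eq_abs, abs_mul, abs_of_nonneg hf0]
  rcases le_total |u| ε with h | h
  · nlinarith [abs_nonneg u]
  · have : f u = 0 := max_eq_right (by rw [sub_nonpos, le_div_iff₀ hε]; linarith)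
    rw [this, mul_zero]
    exact hε.le

/-- Two projections with traces of sum greater than one have a common approximate range vector. -/
theorem IsFaithfulTracialState.exists_approx_common (hφ : IsFaithfulTracialState φ) {e p : A}
    (he : IsStarProjection e) (hp : IsStarProjection p)
    (h : 1 < reFunctional φ e + reFunctional φ p) {δ : ℝ} (hδ : 0 < δ) :
    ∃ w : A, 0 < ‖w‖ ∧ (1 - δ ^ 2) * ‖w‖ ≤ ‖e * w‖ ∧ ‖(1 - p) * (e * w)‖ ≤ δ * ‖w‖ ∧
      ‖e * w‖ ≤ ‖w‖ := by
  have hee : e * e = e := he.isIdempotentElem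
  have hes : star e = e := he.isSelfAdjoint
  have hps : star p = p := hp.isSelfAdjoint
  have hqp := hp.one_sub
  have hbs : IsSelfAdjoint (1 - e * p * e) := by
    rw [isSelfAdjoint_iff, star_sub, star_one, star_mul, star_mul, hes, hps, mul_assoc]
  obtain ⟨w, hw, hbw⟩ := exists_norm_mul_le_of_not_isUnit hbs (hφ.not_isUnit_one_sub he hp h)
    (pow_pos hδ 2)
  have hcontr : ∀ f : A, IsStarProjection f → ∀ v : A, ‖f * v‖ ≤ ‖v‖ := fun f hf v =>
    (norm_mul_le f v).trans (mul_le_of_le_one_left (norm_nonneg v) (IsStarProjection.norm_le f hf))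
  refine ⟨w, hw, ?_, ?_, hcontr e he w⟩
  -- With `b = 1 - e p e`: `(1 - e) b = 1 - e` controls `(1 - e) w`, and `e (1 - p) e = e b`
  -- controls the square of `(1 - p) e w`.
  · have h1 : (1 - e) * w = (1 - e) * ((1 - e * p * e) * w) := by
      rw [← mul_assoc, mul_sub (1 - e), mul_one, ← mul_assoc, ← mul_assoc, sub_mul 1 e e, one_mul,
        hee, sub_self, zero_mul, zero_mul, sub_zero]
    have h2 : ‖(1 - e) * w‖ ≤ δ ^ 2 * ‖w‖ := by
      rw [h1]
      exact (hcontr _ he.one_sub _).trans hbw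
    have h3 : w = e * w + (1 - e) * w := by rw [← add_mul, add_sub_cancel, one_mul]
    have h4 := norm_add_le (e * w) ((1 - e) * w)
    rw [← h3] at h4
    linarith
  · have h1 : e * (1 - p) * e * w = e * ((1 - e * p * e) * w) := by
      rw [← mul_assoc e, mul_sub e 1 p, mul_sub e 1, mul_one, sub_mul, hee, ← mul_assoc e,
        ← mul_assoc e, hee]
    have h2 : star ((1 - p) * (e * w)) * ((1 - p) * (e * w)) =
        star w * (e * (1 - p) * e * w) := by
      have hqq : (1 - p) * (1 - p) = 1 - p := hqp.isIdempotentElem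
      rw [star_mul, star_mul, hes, hqp.isSelfAdjoint.star_eq]
      calc star w * e * (1 - p) * ((1 - p) * (e * w))
          = star w * (e * ((1 - p) * (1 - p)) * e * w) := by simp only [mul_assoc]
        _ = _ := by rw [hqq]
    have h3 : ‖(1 - p) * (e * w)‖ * ‖(1 - p) * (e * w)‖ ≤ (δ * ‖w‖) * (δ * ‖w‖) := by
      rw [← CStarRing.norm_star_mul_self, h2, h1]
      refine (norm_mul_le _ _).trans ?_
      rw [norm_star]
      nlinarith [hcontr e he ((1 - e * p * e) * w), norm_nonneg w]
    exact abs_le_of_sq_le_sq' (by nlinarith) (by positivity) |>.2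

namespace TNormModel

variable {k : ℕ} {t : ℝ} (M : TNormModel φ k t)

theorem norm_embed_le (x : Fin k → ℝ) : ‖M.embed x‖ ≤ ‖x‖ := by
  by_cases hA : Nontrivial A
  · have key : ∀ c ∈ spectrum ℝ (M.embed x), |c| ≤ ‖x‖ := by
      intro c hc
      have hc' : c ∈ spectrum ℝ x := AlgHom.spectrum_apply_subset M.embed x hc
      rw [spectrum.mem_iff, Pi.isUnit_iff] at hc'
      push Not at hc'
      obtain ⟨i, hi⟩ := hc'
      have : c = x i := by
        simpa [sub_eq_zero] using hi
      rw [this]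
      exact norm_le_pi_norm x i
    rcases CStarAlgebra.norm_or_neg_norm_mem_spectrum (M.isSelfAdjoint_embed x) with h | h
    · simpa using key _ h
    · simpa using key _ h
  · rw [not_nontrivial_iff_subsingleton] at hA
    rw [Subsingleton.elim (M.embed x) 0, norm_zero]
    exact norm_nonneg x

theorem tNorm_le_norm (x : Fin k → ℝ) : M.tNorm x ≤ ‖x‖ := by
  have hp := (IsStarProjection.norm_le M.proj M.isStarProjection_proj)
  calc M.tNorm x ≤ ‖M.proj‖ * ‖M.embed x‖ * ‖M.proj‖ := norm_mul₃_le
    _ ≤ 1 * ‖M.embed x‖ * 1 := by gcongr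
    _ ≤ ‖x‖ := by simpa using M.norm_embed_le x

theorem abs_le_tNorm (ht : 1 - 1 / (k : ℝ) < t) (x : Fin k → ℝ) (i : Fin k) :
    |x i| ≤ M.tNorm x := by
  set e := M.embed (Pi.single i 1) with he
  have hep : IsStarProjection e := by
    refine ⟨?_, M.isSelfAdjoint_embed _⟩
    rw [IsIdempotentElem, he, ← map_mul, ← Pi.single_mul, mul_one]
  have hxe : M.embed x * e = x i • e := by
    rw [he, ← map_mul, ← map_smul]
    congr 1
    ext j
    rcases eq_or_ne j i with rfl | hj <;> simp [*]
  have htr : 1 < reFunctional φ e + reFunctional φ M.proj := by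
    rw [M.reFunctional_proj, reFunctional_apply, he, M.trace_embed, Complex.ofReal_re]
    simp only [Finset.sum_pi_single', Finset.mem_univ, if_true]
    linarith
  have hL := norm_nonneg (M.embed x)
  refine le_of_forall_pos_le_add fun η hη => ?_
  -- Bounds the total error per unit of `δ`: `|x i|` twice (from `δ² ≤ δ` and from `x i • (1 - p)
  -- v`) and `‖M.embed x‖` once.
  set D := 2 * |x i| + ‖M.embed x‖ + 1 with hD
  have hD0 : 0 < D := by positivity
  set δ := min 1 (η / D) with hδ
  have hδ0 : 0 < δ := by positivity
  have hδ1 : δ ≤ 1 := min_le_left _ _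
  have hδD : δ * D ≤ η := (le_div_iff₀ hD0).1 (min_le_right _ _)
  obtain ⟨w, hw, h1, h2, h3⟩ := M.isState.exists_approx_common hep M.isStarProjection_proj htr hδ0
  set v := e * w with hv
  -- `v` is an exact eigenvector of `x`, and `p v` is close to `v`, so the last two terms are small.
  have hid : x i • v = M.proj * M.embed x * M.proj * v + x i • ((1 - M.proj) * v) +
      M.proj * M.embed x * ((1 - M.proj) * v) := by
    have hxv : M.embed x * v = x i • v := by rw [hv, ← mul_assoc, hxe, smul_mul_assoc]
    have : M.proj * M.embed x * v = x i • (M.proj * v) := by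
      rw [mul_assoc, hxv, mul_smul_comm]
    rw [sub_mul, one_mul, mul_sub, this, ← mul_assoc _ M.proj v]
    module
  have hpx : ‖M.proj * M.embed x‖ ≤ ‖M.embed x‖ :=
    (norm_mul_le _ _).trans
      (mul_le_of_le_one_left hL (IsStarProjection.norm_le M.proj M.isStarProjection_proj))
  have hN : 0 ≤ M.tNorm x := norm_nonneg _
  have hmain : |x i| * ‖v‖ ≤ M.tNorm x * ‖w‖ + |x i| * (δ * ‖w‖) +
      ‖M.embed x‖ * (δ * ‖w‖) := by
    calc |x i| * ‖v‖ = ‖x i • v‖ := by rw [norm_smul, Real.norm_eq_abs]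
      _ ≤ ‖M.proj * M.embed x * M.proj * v‖ + ‖x i • ((1 - M.proj) * v)‖ +
          ‖M.proj * M.embed x * ((1 - M.proj) * v)‖ := by
        rw [hid]
        exact norm_add₃_le
      _ ≤ _ := by
        gcongr
        · exact (norm_mul_le _ _).trans (mul_le_mul_of_nonneg_left h3 hN)
        · rw [norm_smul, Real.norm_eq_abs]
          gcongr
        · exact (norm_mul_le _ _).trans (mul_le_mul hpx h2 (norm_nonneg _) hL)
  have hx0 := abs_nonneg (x i)
  have h4 : |x i| * ((1 - δ ^ 2) * ‖w‖) ≤ |x i| * ‖v‖ := mul_le_mul_of_nonneg_left h1 hx0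
  have h5 : |x i| * (1 - δ ^ 2) ≤ M.tNorm x + |x i| * δ + ‖M.embed x‖ * δ := by
    refine le_of_mul_le_mul_right ?_ hw
    linarith
  have h6 : δ ^ 2 ≤ δ := by nlinarith
  nlinarith [mul_le_mul_of_nonneg_left h6 hx0]

/-- For large `t` the `(t)`-norm is the maximum norm. -/
theorem tNorm_eq_norm (ht : 1 - 1 / (k : ℝ) < t) (x : Fin k → ℝ) :
    M.tNorm x = ‖x‖ :=
  le_antisymm (M.tNorm_le_norm x)
    ((pi_norm_le_iff_of_nonneg (norm_nonneg _)).2 fun i => M.abs_le_tNorm ht x i)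

end TNormModel

end ProjectionPair

/-! ### Properties of the `(t)`-norm. -/

section TNorm

variable {A : Type*} [CStarAlgebra A] {φ : A →ₗ[ℂ] ℂ} {A' : Type*} [CStarAlgebra A']
  {φ' : A' →ₗ[ℂ] ℂ}

namespace TNormModel

variable {k : ℕ} {t : ℝ} (M : TNormModel φ k t) (M' : TNormModel φ' k t)

theorem reFunctional_proj_mul_compression_pow (ht : 0 < t) (x : Fin k → ℝ) (n : ℕ) :
    reFunctional φ (M.proj * (M.proj * M.embed x * M.proj) ^ n) =
      t ^ (n + 1) * M.compressedMoment x n := by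
  rw [compressedMoment, smul_pow, mul_smul_comm, map_smul, smul_eq_mul, inv_pow]
  field_simp
  ring

theorem compressedMoment_eq (hk : 1 ≤ k) (ht : 0 < t) {x x' : Fin k → ℝ}
    (h : coordMoment x = coordMoment x') : M.compressedMoment x = M'.compressedMoment x' :=
  eq_of_freeCumulant_eq (by rw [M.compressedMoment_zero ht, M'.compressedMoment_zero ht])
    fun r hr => by
      rw [M.freeCumulant_compressedMoment hk ht x hr, M'.freeCumulant_compressedMoment hk ht x' hr,
        h]

theorem tNorm_le_of_coordMoment_eq (hk : 1 ≤ k) (ht : 0 < t) {x x' : Fin k → ℝ}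
    (h : coordMoment x = coordMoment x') : M.tNorm x ≤ M'.tNorm x' := by
  refine M.isState.norm_le_of_moments_le (K := t) M.isStarProjection_proj
    (M.isSelfAdjoint_compression x) (M.proj_mul_compression x) (norm_nonneg _) fun n _ => ?_
  rw [M.reFunctional_proj_mul_compression_pow ht, M.compressedMoment_eq M' hk ht h,
    ← M'.reFunctional_proj_mul_compression_pow ht]
  have h' := M'.isState.reFunctional_proj_mul_pow_le M'.isStarProjection_proj
    (M'.isSelfAdjoint_compression x') n
  rwa [M'.reFunctional_proj] at h'

/-- The `(t)`-norm depends only on the distribution of the coordinates. -/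
theorem tNorm_eq_of_coordMoment_eq (hk : 1 ≤ k) (ht : 0 < t) {x x' : Fin k → ℝ}
    (h : coordMoment x = coordMoment x') : M.tNorm x = M'.tNorm x' :=
  le_antisymm (M.tNorm_le_of_coordMoment_eq M' hk ht h)
    (M'.tNorm_le_of_coordMoment_eq M hk ht h.symm)

theorem tNorm_comp_perm (hk : 1 ≤ k) (ht : 0 < t) (σ : Equiv.Perm (Fin k)) (x : Fin k → ℝ) :
    M.tNorm (fun i => x (σ i)) = M.tNorm x := by
  refine M.tNorm_eq_of_coordMoment_eq M hk ht (funext fun n => ?_)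
  rw [coordMoment, coordMoment, Equiv.sum_comp σ fun i => x i ^ n]

theorem tNorm_smul (c : ℝ) (x : Fin k → ℝ) : M.tNorm (c • x) = |c| * M.tNorm x := by
  rw [tNorm, tNorm, map_smul, mul_smul_comm, smul_mul_assoc, norm_smul, Real.norm_eq_abs]

theorem tNorm_add_le (x y : Fin k → ℝ) : M.tNorm (x + y) ≤ M.tNorm x + M.tNorm y := by
  rw [tNorm, tNorm, tNorm, map_add, mul_add, add_mul]
  exact norm_add_le _ _

theorem tNorm_zero : M.tNorm 0 = 0 := by
  rw [tNorm, map_zero, mul_zero, zero_mul, norm_zero]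

theorem eq_zero_of_tNorm_eq_zero (hk : 1 ≤ k) (ht : 0 < t) {x : Fin k → ℝ} (h : M.tNorm x = 0) :
    x = 0 := by
  have h0 : M.proj * M.embed x * M.proj = M.proj * M.embed 0 * M.proj := by
    rw [norm_eq_zero.1 h, map_zero, mul_zero, zero_mul]
  have hc : M.compressedMoment x = M.compressedMoment 0 := by
    funext n
    rw [compressedMoment, compressedMoment, h0]
  have hm : coordMoment x = coordMoment (0 : Fin k → ℝ) := by
    refine eq_of_freeCumulant_eq (by rw [coordMoment_zero hk, coordMoment_zero hk]) fun r hr => ?_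
    have h1 := M.freeCumulant_compressedMoment hk ht x hr
    rw [hc, M.freeCumulant_compressedMoment hk ht 0 hr] at h1
    exact (mul_left_cancel₀ (by positivity) h1).symm
  have h2 := congrFun hm 2
  have hk' : (k : ℝ) ≠ 0 := by positivity
  have h3 : ∑ i, x i ^ 2 = 0 := by simpa [coordMoment, hk'] using h2
  funext i
  exact pow_eq_zero_iff two_ne_zero |>.1
    ((Finset.sum_eq_zero_iff_of_nonneg fun i _ => sq_nonneg (x i)).1 h3 i (Finset.mem_univ i))

theorem isNormOn_tNorm (hk : 1 ≤ k) (ht : 0 < t) : IsNormOn M.tNorm where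
  nonneg _ := norm_nonneg _
  eq_zero_iff _ := ⟨M.eq_zero_of_tNorm_eq_zero hk ht, fun h => h ▸ M.tNorm_zero⟩
  smul := M.tNorm_smul
  add_le := M.tNorm_add_le

theorem norm_proj (ht : 0 < t) : ‖M.proj‖ = 1 := by
  have h0 : M.proj ≠ 0 := by
    intro h
    have := M.reFunctional_proj
    rw [h, map_zero] at this
    exact ht.ne this
  have h : ‖M.proj‖ * ‖M.proj‖ = ‖M.proj‖ := by
    rw [← CStarRing.norm_star_mul_self, M.isStarProjection_proj.isSelfAdjoint.star_eq,
      M.isStarProjection_proj.isIdempotentElem.eq]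
  exact mul_right_cancel₀ (norm_ne_zero_iff.2 h0) (h.trans (one_mul _).symm)

theorem tNorm_const (ht : 0 < t) (s : ℝ) : M.tNorm (fun _ => s) = |s| := by
  have h : (fun _ => s : Fin k → ℝ) = s • 1 := by
    ext i
    simp
  rw [h, tNorm_smul, tNorm, map_one, mul_one, M.isStarProjection_proj.isIdempotentElem.eq,
    M.norm_proj ht, mul_one]

theorem tNorm_shift_le (ht : 0 < t) (x : Fin k → ℝ) (s : ℝ) :
    M.tNorm (fun i => x i + s) ≤ M.tNorm x + |s| := by
  rw [← M.tNorm_const ht s]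
  exact M.tNorm_add_le x fun _ => s

theorem support_nonempty (M : TNormModel φ k t) (hk : 1 ≤ k) (ht : 0 < t) (x : Fin k → ℝ) :
    (freeConvPower (1 / t) (empiricalMeasure x)).support.Nonempty := by
  have := (M.isFreeConvPower hk ht x).isProbabilityMeasure
  exact MeasureTheory.Measure.nonempty_support (MeasureTheory.IsProbabilityMeasure.ne_zero _)

theorem tNorm_shift_of_eq_sSup (hk : 1 ≤ k) (ht : 0 < t) {s : ℝ} (hs : 0 ≤ s) (x : Fin k → ℝ)
    (h : M.tNorm x = t * sSup (freeConvPower (1 / t) (empiricalMeasure x)).support) :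
    M.tNorm (fun i => x i + s) = M.tNorm x + s := by
  refine le_antisymm ((M.tNorm_shift_le ht x s).trans_eq (by rw [abs_of_nonneg hs])) ?_
  have hmem := (M.isFreeConvPower hk ht x).isCompact_support.sSup_mem (M.support_nonempty hk ht x)
  rw [h]
  exact (le_abs_self _).trans (M.abs_le_tNorm_of_mem_support hk ht x s hmem)

theorem tNorm_shift_of_eq_sInf (hk : 1 ≤ k) (ht : 0 < t) {s : ℝ} (hs : s ≤ 0) (x : Fin k → ℝ)
    (h : M.tNorm x = -(t * sInf (freeConvPower (1 / t) (empiricalMeasure x)).support)) :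
    M.tNorm (fun i => x i + s) = M.tNorm x - s := by
  refine le_antisymm ((M.tNorm_shift_le ht x s).trans_eq (by rw [abs_of_nonpos hs]; ring)) ?_
  have hmem := (M.isFreeConvPower hk ht x).isCompact_support.sInf_mem (M.support_nonempty hk ht x)
  have := (neg_le_abs _).trans (M.abs_le_tNorm_of_mem_support hk ht x s hmem)
  linarith

theorem tNorm_eq_max_shift (hk : 1 ≤ k) (ht : 0 < t) {s : ℝ} (hs : 0 ≤ s) (x : Fin k → ℝ) :
    M.tNorm x = max (M.tNorm (fun i => s + x i) - s) (M.tNorm (fun i => s - x i) - s) := by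
  have e1 : (fun i => s + x i) = fun i => x i + s := funext fun i => add_comm _ _
  have e2 : (fun i => s - x i) = fun i => (-x) i + s := funext fun i => by simp; ring
  have hneg : M.tNorm (-x) = M.tNorm x := by simpa using M.tNorm_smul (-1) x
  have h1 := M.tNorm_shift_le ht x s
  have h2 := M.tNorm_shift_le ht (-x) s
  rw [abs_of_nonneg hs] at h1 h2
  rw [e1, e2, max_sub_sub_right]
  refine le_antisymm ?_ (by rw [sub_le_iff_le_add]; exact max_le h1 (h2.trans_eq (by rw [hneg])))
  rw [le_sub_iff_add_le]
  -- The spectral shift needs a nonzero compression; for `x = 0` both shifts are constant.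
  by_cases hx : M.tNorm x = 0
  · have := M.eq_zero_of_tNorm_eq_zero hk ht hx
    subst this
    refine le_max_of_le_left ?_
    simp [M.tNorm_const ht, hx, abs_of_nonneg hs]
  · have h := norm_add_le_max_of_proj M.isStarProjection_proj (M.isSelfAdjoint_compression x)
      (M.proj_mul_compression x) (norm_ne_zero_iff.1 hx) hs
    have hpp : M.proj * M.proj = M.proj := M.isStarProjection_proj.isIdempotentElem
    have hy : ∀ y : Fin k → ℝ, M.proj * M.embed (fun i => y i + s) * M.proj =
        s • M.proj + M.proj * M.embed y * M.proj := by
      intro y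
      have : (fun i => y i + s) = s • (1 : Fin k → ℝ) + y := by
        ext i
        simp [add_comm]
      rw [this, map_add, map_smul, map_one, mul_add, add_mul, mul_smul_comm, mul_one,
        smul_mul_assoc, hpp]
    change ‖M.proj * M.embed x * M.proj‖ + s ≤ max ‖_‖ ‖_‖
    rw [hy, hy, map_neg, mul_neg, neg_mul, ← sub_eq_add_neg]
    exact h

theorem sum_mul_tNorm_orderedNormalization (hk : 1 ≤ k) (ht : 0 < t) {v : Fin k → ℝ}
    (hv : 0 < ∑ i, v i) : (∑ i, v i) * M.tNorm (orderedNormalization v) = M.tNorm v := by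
  have h : orderedNormalization v =
      (∑ i, v i)⁻¹ • fun i => v (Tuple.sort (fun j => -v j) i) := by
    ext i
    simp [orderedNormalization, div_eq_inv_mul]
  rw [h, tNorm_smul, M.tNorm_comp_perm hk ht, abs_of_pos (inv_pos.2 hv), mul_inv_cancel_left₀ hv.ne']

/-- The `(t)`-norm in terms of its restriction to the ordered simplex. -/
theorem tNorm_eq_max_orderedNormalization (hk : 1 ≤ k) (ht : 0 < t) (x : Fin k → ℝ) {s : ℝ}
    (hs : ∀ i, |x i| < s) :
    M.tNorm x = max
      ((∑ i, (s + x i)) * M.tNorm (orderedNormalization fun i => s + x i) - s)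
      ((∑ i, (s - x i)) * M.tNorm (orderedNormalization fun i => s - x i) - s) := by
  have hne : (Finset.univ : Finset (Fin k)).Nonempty := ⟨⟨0, hk⟩, Finset.mem_univ _⟩
  have hs0 : 0 ≤ s := (abs_nonneg _).trans (hs ⟨0, hk⟩).le
  rw [M.sum_mul_tNorm_orderedNormalization hk ht
      (Finset.sum_pos (fun i _ => by linarith [(abs_lt.1 (hs i)).1]) hne),
    M.sum_mul_tNorm_orderedNormalization hk ht
      (Finset.sum_pos (fun i _ => by linarith [(abs_lt.1 (hs i)).2]) hne)]
  exact M.tNorm_eq_max_shift hk ht hs0 x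

theorem tNorm_eq_of_eq_on_orderedSimplex (hk : 1 ≤ k) (ht : 0 < t) {t' : ℝ} (ht' : 0 < t')
    (M' : TNormModel φ' k t') (h : ∀ y ∈ orderedSimplex k, M'.tNorm y = M.tNorm y) :
    M'.tNorm = M.tNorm := by
  funext x
  have hs : ∀ i, |x i| < ‖x‖ + 1 := fun i => (norm_le_pi_norm x i).trans_lt (lt_add_one _)
  have hne : (Finset.univ : Finset (Fin k)).Nonempty := ⟨⟨0, hk⟩, Finset.mem_univ _⟩
  have hv : ∀ i, 0 < ‖x‖ + 1 + x i := fun i => by linarith [(abs_lt.1 (hs i)).1]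
  have hw : ∀ i, 0 < ‖x‖ + 1 - x i := fun i => by linarith [(abs_lt.1 (hs i)).2]
  rw [M.tNorm_eq_max_orderedNormalization hk ht x hs,
    M'.tNorm_eq_max_orderedNormalization hk ht' x hs,
    h _ (orderedNormalization_mem (fun i => (hv i).le) (Finset.sum_pos (fun i _ => hv i) hne)),
    h _ (orderedNormalization_mem (fun i => (hw i).le) (Finset.sum_pos (fun i _ => hw i) hne))]

end TNormModel

end TNorm

theorem mainTheorem12 (k : ℕ) (hk : 1 ≤ k) (t : ℝ) (ht₀ : 0 < t) (ht₁ : t ≤ 1)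
    {A : Type*} [CStarAlgebra A] (φ : A →ₗ[ℂ] ℂ) (M : TNormModel φ k t) :
    -- the `(t)`-norm does not depend on the choices made in its definition
    (∀ (A' : Type*) [CStarAlgebra A'] (φ' : A' →ₗ[ℂ] ℂ) (M' : TNormModel φ' k t),
      M'.tNorm = M.tNorm) ∧
    -- it is a norm
    IsNormOn M.tNorm ∧
    -- (1) invariance under permutations of the coordinates
    (∀ (σ : Equiv.Perm (Fin k)) (x : Fin k → ℝ), M.tNorm (fun i => x (σ i)) = M.tNorm x) ∧
    -- (2) shifts along `1^k`
    (∀ s : ℝ, 0 ≤ s → ∀ x : Fin k → ℝ,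
      M.tNorm x = t * sSup (freeConvPower (1 / t) (empiricalMeasure x)).support →
      M.tNorm (fun i => x i + s) = M.tNorm x + s) ∧
    (∀ s : ℝ, s ≤ 0 → ∀ x : Fin k → ℝ,
      M.tNorm x = -(t * sInf (freeConvPower (1 / t) (empiricalMeasure x)).support) →
      M.tNorm (fun i => x i + s) = M.tNorm x - s) ∧
    -- (3) the restriction to the ordered simplex determines the norm, among all parameters ...
    (∀ t' : ℝ, 0 < t' → t' ≤ 1 →
      ∀ (A' : Type*) [CStarAlgebra A'] (φ' : A' →ₗ[ℂ] ℂ) (M' : TNormModel φ' k t'),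
      (∀ y ∈ orderedSimplex k, M'.tNorm y = M.tNorm y) → M'.tNorm = M.tNorm) ∧
    -- ... and explicitly
    (∀ (x : Fin k → ℝ) (s : ℝ), (∀ i, |x i| < s) →
      M.tNorm x = max
        ((∑ i, (s + x i)) * M.tNorm (orderedNormalization fun i => s + x i) - s)
        ((∑ i, (s - x i)) * M.tNorm (orderedNormalization fun i => s - x i) - s)) ∧
    -- (4) for large `t` it is the maximum norm
    (1 - 1 / (k : ℝ) < t → ∀ x : Fin k → ℝ, M.tNorm x = ‖x‖) := by
  exact ⟨fun A' _ φ' M' => funext fun x => M'.tNorm_eq_of_coordMoment_eq M hk ht₀ rfl,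
    M.isNormOn_tNorm hk ht₀, fun σ x => M.tNorm_comp_perm hk ht₀ σ x,
    fun s hs x h => M.tNorm_shift_of_eq_sSup hk ht₀ hs x h,
    fun s hs x h => M.tNorm_shift_of_eq_sInf hk ht₀ hs x h,
    fun t' ht' _ A' _ φ' M' h => M.tNorm_eq_of_eq_on_orderedSimplex hk ht₀ ht' M' h,
    fun x s hs => M.tNorm_eq_max_orderedNormalization hk ht₀ x hs,
    fun ht x => M.tNorm_eq_norm ht x⟩
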